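/- **Setting.** Fix $1<p<\infty$ and let $L_p$ be the real space $L_p[0,1]$ with Lebesgue measure $|\cdot|$; inclusions and intersections of subsets of $[0,1]$ are understood up to null sets. Let $\mathcal D^n=\{[\frac{i-1}{2^n},\frac{i}{2^n}):1\le i\le 2^n\}$ and $\mathcal D=\bigcup_{n\ge0}\mathcal D^n$. For $I\in\mathcal D$ let $I^+,I^-$ be its left and right halves, $\pi(I^\pm)=I$, $\epsilon(I^\pm)=\pm1$, and $h_I=\chi_{I^+}-\chi_{I^-}$. For $n\in\mathbb N$ let $L_p^{n,0}$ be the linear span of $\{h_I: I\in\mathcal D^k,\ 0\le k<n\}$. A linear map between subspaces of $L_p$ is a *distributional embedding* if it preserves the distribution of every function. For $I=[a,b)\in\mathcal D$ let $T_I:L_p\to L_p$ be given by $(T_If)(t)=f(\frac{t-a}{b-a})$ for $t\in I$ and $(T_If)(t)=0$ otherwise. For every countable limit ordinal $\alpha$ fix distributional embeddings $T^\alpha_\beta:L_p\to L_p$, $0\le\beta<\alpha$, with independent ranges, i.e. such that $(T_\beta^\alpha f_\beta)_{\beta<\alpha}$ is independent for all $(f_\beta)_{\beta<\alpha}$ in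 $L_p$. **Trees.** Put $\kappa(0)=0$, $\kappa(\alpha)=0$ for limit ordinals $\alpha$, and $\kappa(\alpha+1)=\kappa(\alpha)+1$. Define sets $\mathcal T_\alpha$, $1\le\alpha<\omega_1$, of finite sequences of ordinals and dyadic intervals by: $\mathcal T_n=\{(n)\}$ for $n\in\mathbb N$; $\mathcal T_\alpha=\bigcup_{1\le\beta<\alpha}\{(\alpha)^\smallfrown\lambda:\lambda\in\mathcal T_\beta\}$ for limit $\alpha$; and $\mathcal T_\alpha=\{(\alpha)\}\cup\{(\alpha,I)^\smallfrown\lambda:I\in\mathcal D^{\kappa(\alpha)},\lambda\in\mathcal T_\beta\}$ if $\alpha=\beta+\kappa(\alpha)$ is an infinite successor with $\beta$ limit. They are ordered by the initial-segment relation $\sqsubseteq$. For $\lambda\in\mathcal T_\alpha$, $\kappa(\lambda)$ denotes $\kappa$ of its last entry, and $\theta_\lambda\in(0,1]$, $T_\lambda:L_p\to L_p$ are defined by $\theta_{(\alpha)}=1$, $T_{(\alpha)}=\mathrm{id}$ for $\alpha$ a successor; $\theta_\lambda=\theta_\mu$, $T_\lambda=T^\alpha_\beta T_\mu$ if $\lambda=(\alpha)^\smallfrown\mu$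 with $\alpha$ limit and $\mu\in\mathcal T_\beta$; and $\theta_\lambda=|I|\theta_\mu$, $T_\lambda=T_IT_\mu$ if $\lambda=(\alpha,I)^\smallfrown\mu$. Let $X_\lambda=T_\lambda(L_p^{\kappa(\lambda),0})$, and let $\mathrm{supp}(X_\lambda)$ be the essentially smallest measurable set outside of which all members of $X_\lambda$ vanish a.e.; $\lambda,\mu$ are *disjointly supported* if $\mathrm{supp}(X_\lambda)\cap\mathrm{supp}(X_\mu)=\emptyset$. A subset $\mathcal E$ of $\mathcal T_\alpha$ is an *interval-branching subtree* if it contains every $\lambda\in\mathcal T_\alpha$ with $\lambda\sqsubseteq\lambda'$ for some $\lambda'\in\mathcal E$, and for every $\lambda\in\mathcal E$ that is non-maximal in $\mathcal E$ and every $I\in\mathcal D^{\kappa(\lambda)}$ there is $\lambda'\in\mathcal E$ with $\lambda^\smallfrown I\sqsubseteq\lambda'$. **Distributional embedding schemes.** Let $\alpha,\beta<\omega_1$ and let $\mathcal E\subset\mathcal T_\alpha$, $\mathcal F\subset\mathcal T_\beta$ be interval-branching subtrees. A *distributional embedding scheme* is a collection $\Psi=(\mathcal M_\lambda,(J_\mu)_{\mu\in\mathcal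 M_\lambda})_{\lambda\in\mathcal E}$, where each $\mathcal M_\lambda$ is a finite subset of $\mathcal F$ and each $J_\mu:L_p^{\kappa(\lambda),0}\to L_p^{\kappa(\mu),0}$, $\mu\in\mathcal M_\lambda$, is a distributional embedding, such that: 1. for every $\lambda\in\mathcal E$, the members of $\mathcal M_\lambda$ are pairwise disjointly supported and $\sum_{\mu\in\mathcal M_\lambda}\theta_\mu=\theta_\lambda$; 2. if $\lambda_1,\lambda_2\in\mathcal E$ are incomparable and $\mu_i\in\mathcal M_{\lambda_i}$ ($i=1,2$), then $\mu_1,\mu_2$ are incomparable; 3. if $\lambda_0$ is the immediate predecessor in $\mathcal E$ of $\lambda\in\mathcal E$ and $I\in\mathcal D^{\kappa(\lambda_0)}$ satisfies $\lambda_0{}^\smallfrown I\sqsubseteq\lambda$, then for every $\mu\in\mathcal M_\lambda$ there are $\mu_0\in\mathcal M_{\lambda_0}$ and $P\in\mathcal D^{\kappa(\mu_0)}$ with $\mu_0{}^\smallfrown P\sqsubseteq\mu$ and $P\subset[J_{\mu_0}h_{\pi(I)}=\epsilon(I)]$. For $\lambda\in\mathcal E$, $\mu\in\mathcal F$ and $J\in\mathcal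 D^{\kappa(\mu)}$ put $\Gamma_\lambda^\mu=\{\nu\in\mathcal M_\lambda:\mu\sqsubseteq\nu\}$ and $\Gamma_\lambda^{\mu^\smallfrown J}=\{\nu\in\mathcal M_\lambda:\mu^\smallfrown J\sqsubseteq\nu\}$. For $\lambda\in\mathcal E$, $I\in\mathcal D^{\kappa(\lambda)}$ and $\mu\in\mathcal M_\lambda$ put $\mathcal D_I^{\kappa(\mu)}=\{P\in\mathcal D^{\kappa(\mu)}:P\subset[J_\mu h_{\pi(I)}=\epsilon(I)]\}$. **Proposition.** Let $\Psi$ be a distributional embedding scheme as above, let $\mu_0\in\mathcal F$, and let $\lambda_0\in\mathcal E$ be minimal with respect to $\sqsubseteq$ such that $\Gamma_{\lambda_0}^{\mu_0}\ne\emptyset$ (assuming that such a $\lambda_0$ exists). Then: (a) for every $\lambda\in\mathcal E$ with $\lambda\sqsupseteq\lambda_0$, $$\sum_{\nu\in\Gamma_\lambda^{\mu_0}}\theta_\nu=\theta_{\mu_0}\frac{\theta_\lambda}{\theta_{\lambda_0}};$$ (b) if $\mu_0\notin\mathcal M_{\lambda_0}$, then for every $J\in\mathcal D^{\kappa(\mu_0)}$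 and every $\lambda\in\mathcal E$ with $\lambda\sqsupseteq\lambda_0$, $$\sum_{\nu\in\Gamma_\lambda^{\mu_0{}^\smallfrown J}}\theta_\nu=\theta_{\mu_0}|J|\frac{\theta_\lambda}{\theta_{\lambda_0}};$$ (c) if $\mu_0\in\mathcal M_{\lambda_0}$, then for every $I\in\mathcal D^{\kappa(\lambda_0)}$, every $J\in\mathcal D_I^{\kappa(\mu_0)}$ and every $\lambda\in\mathcal E$ with $\lambda\sqsupseteq\lambda_0{}^\smallfrown I$, $$\sum_{\nu\in\Gamma_\lambda^{\mu_0{}^\smallfrown J}}\theta_\nu=\theta_{\mu_0}\frac{|J|}{|I|}\frac{\theta_\lambda}{\theta_{\lambda_0}}.$$ -/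

import Mathlib

open MeasureTheory ProbabilityTheory Set
open scoped ENNReal Ordinal

noncomputable section

namespace BRS

/-! ### DyadicInterval intervals -/

/-- The dyadic interval `[idx / 2 ^ level, (idx + 1) / 2 ^ level)` of `[0, 1)`. The set `𝓓ⁿ` is the
set of all `I` with `I.level = n`. -/
@[ext]
structure DyadicInterval where
  level : ℕ
  idx : ℕ
  idx_lt : idx < 2 ^ level

namespace DyadicInterval

/-- Left end point. -/
def left (I : DyadicInterval) : ℝ := (I.idx : ℝ) / 2 ^ I.level

/-- Right end point. -/
def right (I : DyadicInterval) : ℝ := ((I.idx : ℝ) + 1) / 2 ^ I.level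

/-- The dyadic interval as a set of reals. -/
def toSet (I : DyadicInterval) : Set ℝ := Ico I.left I.right

/-- The length `|I|`, i.e. the Lebesgue measure of `I`. -/
def length (I : DyadicInterval) : ℝ := volume.real I.toSet

/-- The left half `I⁺`. -/
def plus (I : DyadicInterval) : DyadicInterval :=
  ⟨I.level + 1, 2 * I.idx, by have := I.idx_lt; rw [pow_succ]; omega⟩

/-- The right half `I⁻`. -/
def minus (I : DyadicInterval) : DyadicInterval :=
  ⟨I.level + 1, 2 * I.idx + 1, by have := I.idx_lt; rw [pow_succ]; omega⟩

/-- The immediate predecessor `π(I)`, i.e. `π(I⁺) = π(I⁻) = I`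
(irrelevant value `[0, 1)` at `[0, 1)`). -/
def parent (I : DyadicInterval) : DyadicInterval :=
  ⟨I.level - 1, I.idx / 2, by
    rcases I with ⟨_ | n, i, h⟩
    · simp at h ⊢; omega
    · rw [pow_succ] at h; simp only [Nat.add_sub_cancel]; omega⟩

/-- The sign `ε(I)`: `ε(I⁺) = 1` and `ε(I⁻) = -1` (irrelevant value at `[0, 1)`). -/
def sign (I : DyadicInterval) : ℝ := if Even I.idx then 1 else -1

theorem parent_plus (I : DyadicInterval) : I.plus.parent = I := by
  ext <;> simp [parent, plus]

theorem parent_minus (I : DyadicInterval) : I.minus.parent = I := by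
  ext
  · simp [parent, minus]
  · simp only [parent, minus]; omega

theorem sign_plus (I : DyadicInterval) : I.plus.sign = 1 := by
  simp [sign, plus]

theorem sign_minus (I : DyadicInterval) : I.minus.sign = -1 := by
  simp [sign, minus]

theorem right_sub_left (I : DyadicInterval) : I.right - I.left = 1 / 2 ^ I.level := by
  unfold right left; ring

theorem left_lt_right (I : DyadicInterval) : I.left < I.right := by
  have h := I.right_sub_left
  have : (0 : ℝ) < 1 / 2 ^ I.level := by positivity
  linarith

theorem length_eq (I : DyadicInterval) : I.length = 1 / 2 ^ I.level := by
  rw [length, toSet, Real.volume_real_Ico_of_le I.left_lt_right.le, right_sub_left]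

theorem measurableSet_toSet (I : DyadicInterval) : MeasurableSet I.toSet := measurableSet_Ico

end DyadicInterval

/-! ### The space `L_p = L_p[0, 1]` and its standard finite-dimensional subspaces -/

/-- Lebesgue measure on `[0, 1]`. -/
def leb : Measure ℝ := volume.restrict (Icc 0 1)

instance : IsProbabilityMeasure leb := ⟨by simp [leb]⟩

/-- The real space `L_p = L_p[0, 1]`. -/
abbrev LpI (p : ℝ≥0∞) : Type := Lp ℝ p leb

/-- The characteristic function `χ_I` in `L_p`. -/
def chi (p : ℝ≥0∞) (I : DyadicInterval) : LpI p :=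
  indicatorConstLp p I.measurableSet_toSet (measure_ne_top leb _) (1 : ℝ)

/-- The Haar function `h_I = χ_{I⁺} - χ_{I⁻}`. -/
def haar (p : ℝ≥0∞) (I : DyadicInterval) : LpI p := chi p I.plus - chi p I.minus

/-- `L_p^{n,0}`, the linear span of the `h_I` with `I ∈ 𝓓_{n-1}`; these are the functions of
mean zero that are constant on each dyadic interval of length `2⁻ⁿ`. -/
def LpZero (p : ℝ≥0∞) (n : ℕ) : Submodule ℝ (LpI p) :=
  Submodule.span ℝ (haar p '' {I | I.level < n})

/-- The Haar function `h_I` as a member of `L_p^{n,0}`, for `I ∈ 𝓓_{n-1}`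
(irrelevant value `0` for other `I`). -/
def haarIn (p : ℝ≥0∞) (n : ℕ) (I : DyadicInterval) : LpZero p n :=
  if h : I.level < n then ⟨haar p I, Submodule.subset_span ⟨I, h, rfl⟩⟩ else 0

/-- A linear operator between subspaces of `L_p` is a distributional embedding if it preserves the
distribution of every function. -/
def IsDistEmbedding {p : ℝ≥0∞} {X Y : Submodule ℝ (LpI p)} (T : X →ₗ[ℝ] Y) : Prop :=
  ∀ f : X, leb.map ((T f : LpI p) : ℝ → ℝ) = leb.map ((f : LpI p) : ℝ → ℝ)

/-! ### The compressions `T_I` -/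

/-- The pointwise formula for `T_I f`. -/
def compressFun (I : DyadicInterval) (f : ℝ → ℝ) : ℝ → ℝ :=
  I.toSet.indicator fun t => f ((t - I.left) / (I.right - I.left))

theorem map_affine_le (I : DyadicInterval) :
    ((leb.restrict I.toSet).map fun t => (t - I.left) / (I.right - I.left)) ≤
      ENNReal.ofReal (I.right - I.left) • leb := by
  have hd : 0 < I.right - I.left := sub_pos.2 I.left_lt_right
  have hm : Measurable fun t : ℝ => (t - I.left) / (I.right - I.left) := by fun_prop
  have key : (volume.map fun t : ℝ => (t - I.left) / (I.right - I.left)) =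
      ENNReal.ofReal (I.right - I.left) • (volume : Measure ℝ) := by
    have h1 : (fun t : ℝ => (t - I.left) / (I.right - I.left)) =
        (fun t => (I.right - I.left)⁻¹ * t) ∘ fun t => t + (-I.left) := by
      funext t; simp only [Function.comp]; field_simp; ring
    rw [h1, ← Measure.map_map (by fun_prop) (by fun_prop), map_add_right_eq_self,
      Real.map_volume_mul_left (inv_ne_zero hd.ne'), inv_inv, abs_of_pos hd]
  refine Measure.le_iff.2 fun s hs => ?_
  rw [Measure.map_apply hm hs, Measure.restrict_apply (hm hs), Measure.smul_apply]
  simp only [leb]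
  rw [Measure.restrict_apply hs]
  have h2 : ENNReal.ofReal (I.right - I.left) • volume (s ∩ Icc (0 : ℝ) 1) =
      volume ((fun t : ℝ => (t - I.left) / (I.right - I.left)) ⁻¹' (s ∩ Icc 0 1)) := by
    rw [← Measure.map_apply hm (hs.inter measurableSet_Icc), key]; rfl
  rw [h2]
  refine (Measure.restrict_apply_le _ _).trans (measure_mono ?_)
  rintro t ⟨hts, ht1, ht2⟩
  refine ⟨hts, div_nonneg (by linarith) hd.le, ?_⟩
  rw [div_le_one hd]; linarith

theorem memLp_compressFun {p : ℝ≥0∞} (I : DyadicInterval) {f : ℝ → ℝ} (hf : MemLp f p leb) :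
    MemLp (compressFun I f) p leb := by
  rw [compressFun, memLp_indicator_iff_restrict I.measurableSet_toSet]
  refine MemLp.comp_of_map (g := f) ?_ (by fun_prop)
  exact hf.of_measure_le_smul ENNReal.ofReal_ne_top (map_affine_le I)

theorem compressFun_congr (I : DyadicInterval) {f g : ℝ → ℝ} (h : f =ᵐ[leb] g) :
    compressFun I f =ᵐ[leb] compressFun I g := by
  have h1 : f =ᵐ[(leb.restrict I.toSet).map fun t => (t - I.left) / (I.right - I.left)] g :=
    (Measure.absolutelyContinuous_of_le_smul (map_affine_le I)).ae_le h
  have h2 := ae_of_ae_map (by fun_prop) h1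
  rw [ae_restrict_iff' I.measurableSet_toSet] at h2
  filter_upwards [h2] with t ht
  by_cases hI : t ∈ I.toSet
  · simpa [compressFun, hI] using ht hI
  · simp [compressFun, hI]

/-- The compression `T_I : L_p → L_p`, `(T_I f)(t) = f ((t - a) / (b - a))` for `t ∈ I = [a, b)`,
and `(T_I f)(t) = 0` otherwise. -/
def compress (p : ℝ≥0∞) (I : DyadicInterval) : LpI p →ₗ[ℝ] LpI p where
  toFun f := (memLp_compressFun I (Lp.memLp f)).toLp _
  map_add' f g := by
    rw [← MemLp.toLp_add]
    refine MemLp.toLp_congr _ _ ((compressFun_congr I (Lp.coeFn_add f g)).trans ?_)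
    refine Filter.Eventually.of_forall fun t => ?_
    by_cases hI : t ∈ I.toSet <;> simp [compressFun, hI]
  map_smul' c f := by
    rw [RingHom.id_apply, ← MemLp.toLp_const_smul]
    refine MemLp.toLp_congr _ _ ((compressFun_congr I (Lp.coeFn_smul c f)).trans ?_)
    refine Filter.Eventually.of_forall fun t => ?_
    by_cases hI : t ∈ I.toSet <;> simp [compressFun, hI]

/-- A choice, for each countable limit ordinal `α`, of distributional embeddings
`T_β^α : L_p → L_p`, `β < α`, with independent ranges. Such a choice is made once and for all in
the construction of the Bourgain-Rosenthal-Schechtman spaces. -/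
structure LimitEmbeddings (p : ℝ≥0∞) where
  /-- `T α β` is the operator `T_β^α`. -/
  T : Ordinal.{0} → Ordinal.{0} → LpI p →ₗ[ℝ] LpI p
  dist_eq : ∀ α β, Order.IsSuccLimit α → α < ω₁ → β < α → ∀ f : LpI p,
    leb.map (T α β f : ℝ → ℝ) = leb.map (f : ℝ → ℝ)
  indep : ∀ α, Order.IsSuccLimit α → α < ω₁ → ∀ f : Iio α → LpI p,
    iIndepFun (fun β : Iio α => (T α β (f β) : ℝ → ℝ)) leb

/-! ### The trees `𝓣_α` -/

/-- The integer part `κ(α)`: `κ(0) = 0`, `κ(α) = 0` for limit `α`, and `κ(α + 1) = κ(α) + 1`. -/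
def kappaOrd (α : Ordinal.{0}) : ℕ :=
  Ordinal.limitRecOn α 0 (fun _ n => n + 1) (fun _ _ _ => 0)

theorem kappaOrd_zero : kappaOrd 0 = 0 := Ordinal.limitRecOn_zero ..

theorem kappaOrd_add_one (α : Ordinal.{0}) : kappaOrd (α + 1) = kappaOrd α + 1 :=
  Ordinal.limitRecOn_add_one ..

theorem kappaOrd_limit {α : Ordinal.{0}} (h : Order.IsSuccLimit α) : kappaOrd α = 0 :=
  Ordinal.limitRecOn_limit _ _ _ _ h

/-- An entry of a sequence: an ordinal number or a dyadic interval. -/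
inductive Entry where
  | ord (a : Ordinal.{0})
  | int (I : DyadicInterval)

/-- Finite sequences of ordinal numbers and dyadic intervals. They are ordered by the
initial-segment order `<+:`. -/
abbrev Node : Type 1 := List Entry

/-- `InTree α l` says that `l ∈ 𝓣_α`. If `α` is a limit ordinal, `𝓣_α` consists of all `(α)⌢l` with
`l ∈ 𝓣_β` and `1 ≤ β < α`. If `α = β + κ(α)` is a successor with `β` limit or zero, it consists of
`(α)` and all `(α, I)⌢l` with `I ∈ 𝓓^{κ(α)}` and `l ∈ 𝓣_β`. As `𝓣_0` is empty, `𝓣_n = {(n)}`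
for `1 ≤ n < ω`. -/
inductive InTree : Ordinal.{0} → Node → Prop
  | limit {α β : Ordinal.{0}} {l : Node} (hα : Order.IsSuccLimit α) (h1 : 1 ≤ β) (hβ : β < α)
      (hl : InTree β l) : InTree α (Entry.ord α :: l)
  | head (γ : Ordinal.{0}) : InTree (γ + 1) [Entry.ord (γ + 1)]
  | succ {α β : Ordinal.{0}} {I : DyadicInterval} {l : Node} (hα : ∃ γ, α = γ + 1)
      (hβ : β = 0 ∨ Order.IsSuccLimit β) (hαβ : α = β + (kappaOrd α : Ordinal.{0}))
      (hI : I.level = kappaOrd α) (hl : InTree β l) :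
      InTree α (Entry.ord α :: Entry.int I :: l)

/-- The tree `𝓣_α`. -/
def tree (α : Ordinal.{0}) : Set Node := {l | InTree α l}

/-- `κ(l)`, the integer part of the last entry of `l` (an ordinal if `l` is in a tree). -/
def kappa (l : Node) : ℕ :=
  match l.getLast? with
  | some (Entry.ord a) => kappaOrd a
  | _ => 0

/-- `l⌢I`. -/
def snoc (l : Node) (I : DyadicInterval) : Node := l ++ [Entry.int I]

/-- Two nodes are incomparable if neither is an initial segment of the other. -/
def Incomparable (l m : Node) : Prop := ¬ l <+: m ∧ ¬ m <+: l

/-- The number `θ_l`, by recursion on `l`: an entry `I ∈ 𝓓` contributes the factor `|I|`. -/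
def theta : Node → ℝ
  | [] => 1
  | Entry.ord _ :: l => theta l
  | Entry.int I :: l => I.length * theta l

/-- The operator `T_l : L_p → L_p`, by recursion on `l`: the identity for `l = (α)`,
`T_β^α ∘ T_m` for `l = (α)⌢m` with `m` starting with `β`, and `T_I ∘ T_m` for `l = (α, I)⌢m`. -/
def nodeOp {p : ℝ≥0∞} (U : LimitEmbeddings p) : Node → LpI p →ₗ[ℝ] LpI p
  | [] => LinearMap.id
  | [Entry.ord _] => LinearMap.id
  | Entry.ord a :: Entry.ord b :: l => U.T a b ∘ₗ nodeOp U (Entry.ord b :: l)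
  | Entry.ord _ :: Entry.int I :: l => nodeOp U (Entry.int I :: l)
  | Entry.int I :: l => compress p I ∘ₗ nodeOp U l

/-- The space `X_l = T_l (L_p^{κ(l),0})`. -/
def nodeSpace {p : ℝ≥0∞} (U : LimitEmbeddings p) (l : Node) : Submodule ℝ (LpI p) :=
  (LpZero p (kappa l)).map (nodeOp U l)

/-! ### Supports -/

/-- `supp(X) ⊂ A` in the essential sense. -/
def SuppSubset {p : ℝ≥0∞} (X : Submodule ℝ (LpI p)) (A : Set ℝ) : Prop :=
  ∀ f ∈ X, ∀ᵐ t ∂leb, (f : ℝ → ℝ) t ≠ 0 → t ∈ A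

/-- `supp(X) = A`: `A` is the essentially smallest measurable set with `supp(X) ⊂ A`. -/
def IsSupp {p : ℝ≥0∞} (X : Submodule ℝ (LpI p)) (A : Set ℝ) : Prop :=
  MeasurableSet A ∧ SuppSubset X A ∧
    ∀ B, MeasurableSet B → SuppSubset X B → ∀ᵐ t ∂leb, t ∈ A → t ∈ B

/-- `l` and `m` are disjointly supported: `supp(X_l) ∩ supp(X_m) = ∅` in the essential sense. -/
def DisjointlySupported {p : ℝ≥0∞} (U : LimitEmbeddings p) (l m : Node) : Prop :=
  ∃ A B, IsSupp (nodeSpace U l) A ∧ IsSupp (nodeSpace U m) B ∧ leb (A ∩ B) = 0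

/-! ### Subtrees and distributional embedding schemes -/

/-- A subtree of `𝓣_α`: a subset closed under initial segments that lie in `𝓣_α`. -/
def IsSubtree (α : Ordinal.{0}) (E : Set Node) : Prop :=
  E ⊆ tree α ∧ ∀ l₀ ∈ E, ∀ l ∈ tree α, l <+: l₀ → l ∈ E

/-- A subtree in which every non-maximal member `l₀` has, for every `I ∈ 𝓓^{κ(l₀)}`, an extension
along `I`. -/
def IsIntervalBranching (α : Ordinal.{0}) (E : Set Node) : Prop :=
  IsSubtree α E ∧ ∀ l₀ ∈ E, (∃ l ∈ E, l₀ <+: l ∧ l₀ ≠ l) →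
    ∀ I : DyadicInterval, I.level = kappa l₀ → ∃ l ∈ E, snoc l₀ I <+: l

/-- `l₀` is the immediate (i.e. maximum) predecessor of `l` in `E`. -/
def IsImmediatePred (E : Set Node) (l₀ l : Node) : Prop :=
  (l₀ ∈ E ∧ l₀ <+: l ∧ l₀ ≠ l) ∧ ∀ k ∈ E, k <+: l → k ≠ l → k <+: l₀

/-- For `J : L_p^{m,0} → L_p^{n,0}` and `I ∈ 𝓓^m`, the set of all `P ∈ 𝓓ⁿ` with
`P ⊂ [J h_{π(I)} = ε(I)]` in the essential sense. -/
def dyadicAlong {p : ℝ≥0∞} {m n : ℕ} (J : LpZero p m →ₗ[ℝ] LpZero p n) (I : DyadicInterval) :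
    Set DyadicInterval :=
  {P | P.level = n ∧
    ∀ᵐ t ∂leb, t ∈ P.toSet → ((J (haarIn p m I.parent) : LpI p) : ℝ → ℝ) t = I.sign}

/-- A distributional embedding scheme `Ψ = (M_l, (J_m)_{m ∈ M_l})_{l ∈ E}` of `R_E` in `R_F`. The
operator `J_m`, for `m ∈ M_l`, is `J l m`. Values of `M` and `J` outside `l ∈ E`, `m ∈ M l` play no
role. -/
structure DES {p : ℝ≥0∞} (U : LimitEmbeddings p) (E F : Set Node) where
  M : Node → Finset Node
  J : ∀ l m : Node, LpZero p (kappa l) →ₗ[ℝ] LpZero p (kappa m)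
  M_subset : ∀ l ∈ E, ∀ m ∈ M l, m ∈ F
  J_dist : ∀ l ∈ E, ∀ m ∈ M l, IsDistEmbedding (J l m)
  disjoint : ∀ l ∈ E, ∀ m ∈ M l, ∀ m' ∈ M l, m ≠ m' → DisjointlySupported U m m'
  sum_theta : ∀ l ∈ E, ∑ m ∈ M l, theta m = theta l
  incomparable : ∀ l₁ ∈ E, ∀ l₂ ∈ E, Incomparable l₁ l₂ →
    ∀ m₁ ∈ M l₁, ∀ m₂ ∈ M l₂, Incomparable m₁ m₂
  along : ∀ l ∈ E, ∀ l₀, IsImmediatePred E l₀ l →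
    ∀ I : DyadicInterval, I.level = kappa l₀ → snoc l₀ I <+: l →
      ∀ m ∈ M l, ∃ m₀ ∈ M l₀, ∃ P ∈ dyadicAlong (J l₀ m₀) I, snoc m₀ P <+: m

open Classical in
/-- The set of all `n ∈ M_l` that extend the sequence `s`; for `s = m` this is `Γ_l^m`, and for
`s = m⌢J` it is `Γ_l^{m⌢J}`. -/
def DES.Gamma {p : ℝ≥0∞} {U : LimitEmbeddings p} {E F : Set Node} (Ψ : DES U E F) (l s : Node) :
    Finset Node :=
  (Ψ.M l).filter fun n => s <+: n

end BRS

end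

noncomputable section

namespace BRS

/-! All sums of `theta` are read as measures. To a sequence s is attached the support of T_s h,
where h is the Haar function of [0, 1), which vanishes almost nowhere. Distributional embeddings
preserve the measure of common supports and T_I scales it by |I|, so T_s scales it by θ_s
(`InTree.scalesOverlap`). Hence the set attached to s has measure θ_s, and extending s shrinks the
set (`FactorsThrough.leb_diff`). By independence at limit ordinals, two members of a tree can be
disjoint only if they first differ in an interval (`InTree.overlap_pos_or_branch`).

Let l be an immediate successor of l₀ in E along I. Every member of M_l extends some μ⌢P with μ ∈
M_{l₀} and P ∈ 𝓓_I^{κ(μ)}. For fixed μ these P have total length |I|, because J_μ preserves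
distributions (`sum_length_dyadicAlong`). So all the μ⌢P together have mass |I| θ_{l₀} = θ_l,
exactly the mass of M_l, and each of them must be filled by its extensions
(`DES.sum_Gamma_snoc_eq`). The same count, made separately for the members that extend s and those
that do not, shows that the mass above s, once nonzero, is multiplied by θ_l / θ_{l₀}
(`DES.sum_Gamma_step`). Induction along E propagates this (`DES.sum_Gamma_eq_mul`), and only initial
values remain.

At the minimal l₀, the node μ₀ lies beyond some filled μ⌢P (or beyond the empty sequence, if l₀ has
no predecessor). Members of M_{l₀} not extending μ₀ are disjoint from it, so μ₀ is filled too
(`DES.sum_Gamma_eq_theta`); this gives (a). If μ₀ ∉ M_{l₀}, the same holds for μ₀⌢J, which gives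
(b). In (c) the induction starts at the immediate successors of l₀ along I, where μ₀⌢J is itself one
of the filled μ⌢P. -/

/-! ### Initial segments in the trees -/

theorem InTree.exists_eq_cons {α : Ordinal.{0}} {l : Node} (h : InTree α l) :
    ∃ r, l = Entry.ord α :: r := by
  cases h <;> exact ⟨_, rfl⟩

theorem InTree.ne_nil {α : Ordinal.{0}} {l : Node} (h : InTree α l) : l ≠ [] := by
  obtain ⟨r, rfl⟩ := h.exists_eq_cons
  simp

theorem kappa_cons {l : Node} (e : Entry) (h : l ≠ []) : kappa (e :: l) = kappa l := by
  obtain ⟨x, r, rfl⟩ := List.exists_cons_of_ne_nil h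
  simp [kappa, List.getLast?_cons_cons]

theorem kappa_singleton (α : Ordinal.{0}) : kappa [Entry.ord α] = kappaOrd α := rfl

/-- Since 𝓣_0 is empty, the recursion can only end at a successor ordinal. Positivity puts the Haar
function of [0, 1) into L_p^{κ(l),0} and gives every I of level κ(l) a genuine parent. -/
theorem InTree.kappa_pos {α : Ordinal.{0}} {l : Node} (h : InTree α l) : 0 < kappa l := by
  induction h with
  | limit hα h1 hβ hl ih => rwa [kappa_cons _ hl.ne_nil]
  | head γ => rw [kappa_singleton, kappaOrd_add_one]; omega
  | succ hα hβ hαβ hI hl ih =>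
    rw [kappa_cons _ (by simp), kappa_cons _ hl.ne_nil]; exact ih

/-- Cutting a member of a tree in front of an interval yields a member of the tree. -/
theorem InTree.of_append_int {α : Ordinal.{0}} {l : Node} (h : InTree α l) :
    ∀ {s r : Node} {I : DyadicInterval}, l = s ++ Entry.int I :: r →
      InTree α s ∧ I.level = kappa s := by
  induction h with
  | limit hα h1 hβ hl ih =>
    intro s r I e
    rcases s with _ | ⟨x, s⟩
    · simp at e
    · simp only [List.cons_append, List.cons.injEq] at e
      obtain ⟨rfl, e⟩ := e
      have := ih e
      exact ⟨.limit hα h1 hβ this.1, by rw [kappa_cons _ this.1.ne_nil]; exact this.2⟩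
  | head γ =>
    intro s r I e
    rcases s with _ | ⟨x, s⟩ <;> simp at e
  | succ hα hβ hαβ hI hl ih =>
    intro s r I e
    rcases s with _ | ⟨x, _ | ⟨y, s⟩⟩
    · simp at e
    · simp only [List.cons_append, List.nil_append, List.cons.injEq, Entry.int.injEq] at e
      obtain ⟨rfl, rfl, -⟩ := e
      obtain ⟨γ, rfl⟩ := hα
      exact ⟨.head γ, by rw [kappa_singleton]; exact hI⟩
    · simp only [List.cons_append, List.cons.injEq] at e
      obtain ⟨rfl, rfl, e⟩ := e
      have := ih e
      exact ⟨.succ hα hβ hαβ hI this.1,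
        by rw [kappa_cons _ (by simp), kappa_cons _ this.1.ne_nil]; exact this.2⟩

theorem InTree.of_snoc_prefix {α : Ordinal.{0}} {l s : Node} {I : DyadicInterval}
    (h : InTree α l) (hs : snoc s I <+: l) : InTree α s ∧ I.level = kappa s := by
  obtain ⟨r, rfl⟩ := hs
  exact h.of_append_int (r := r) (by simp [snoc])

theorem prefix_snoc (s : Node) (I : DyadicInterval) : s <+: snoc s I := ⟨_, rfl⟩

theorem not_isSuccLimit_add_one (γ : Ordinal.{0}) : ¬ Order.IsSuccLimit (γ + 1) := by
  intro h
  have := h.isSuccPrelimit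
  rw [← Order.succ_eq_add_one] at this
  exact Order.not_isSuccPrelimit_succ _ this

/-- A proper initial segment in a tree is followed by an interval. -/
theorem InTree.eq_or_snoc_prefix {α : Ordinal.{0}} {l : Node} (h : InTree α l) :
    ∀ {m : Node}, InTree α m → m <+: l → m = l ∨ ∃ I, snoc m I <+: l := by
  induction h with
  | @limit α β l hα h1 hβ hl ih =>
    intro m hm hml
    cases hm with
    | @limit _ β' m' _ h1' hβ' hm' =>
      rw [List.cons_prefix_cons] at hml
      -- The tails start with β' and β, so one being an initial segment of the other forces
      -- equality.
      have e : β' = β := by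
        obtain ⟨r, rfl⟩ := hl.exists_eq_cons
        obtain ⟨r', rfl⟩ := hm'.exists_eq_cons
        have := hml.2
        rw [List.cons_prefix_cons] at this
        simpa using this.1
      subst e
      rcases ih hm' hml.2 with rfl | ⟨I, hI⟩
      · exact .inl rfl
      · exact .inr ⟨I, by simpa [snoc] using hI⟩
    | head γ => exact absurd hα (not_isSuccLimit_add_one γ)
    | succ hα' => 
      obtain ⟨γ, rfl⟩ := hα'
      exact absurd hα (not_isSuccLimit_add_one γ)
  | head γ =>
    intro m hm hml
    obtain ⟨r, rfl⟩ := hm.exists_eq_cons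
    rw [List.cons_prefix_cons] at hml
    left
    rw [List.prefix_nil.1 hml.2]
  | @succ α β I l hα hβ hαβ hI hl ih =>
    intro m hm hml
    cases hm with
    | limit hα' =>
      obtain ⟨γ, rfl⟩ := hα
      exact absurd hα' (not_isSuccLimit_add_one γ)
    | head γ => exact .inr ⟨I, by simp [snoc]⟩
    | @succ _ β' I' m' _ hβ' hαβ' hI' hm' =>
      simp only [List.cons_prefix_cons] at hml
      have e : β' = β := by
        obtain ⟨r, rfl⟩ := hl.exists_eq_cons
        obtain ⟨r', rfl⟩ := hm'.exists_eq_cons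
        have := hml.2.2
        rw [List.cons_prefix_cons] at this
        simpa using this.1
      subst e
      rcases ih hm' hml.2.2 with rfl | ⟨K, hK⟩
      · left; rw [hml.2.1]
      · right; exact ⟨K, by simpa [snoc, hml.2.1] using hK⟩

/-! ### Weights, branching and immediate predecessors -/

theorem theta_append (l m : Node) : theta (l ++ m) = theta l * theta m := by
  induction l with
  | nil => simp [theta]
  | cons e l ih => cases e <;> simp [theta, ih, mul_assoc]

theorem theta_snoc (l : Node) (I : DyadicInterval) :
    theta (snoc l I) = theta l * I.length := by
  simp [snoc, theta_append, theta]

theorem DyadicInterval.length_pos (I : DyadicInterval) : 0 < I.length := by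
  rw [length_eq]; positivity

theorem theta_pos (l : Node) : 0 < theta l := by
  induction l with
  | nil => simp [theta]
  | cons e l ih =>
    cases e with
    | ord a => exact ih
    | int I => exact mul_pos I.length_pos ih

theorem theta_eq_one {l : Node} (h : ∀ s I, ¬ snoc s I <+: l) : theta l = 1 := by
  induction l with
  | nil => rfl
  | cons e l ih =>
    cases e with
    | ord a =>
      exact ih fun s I hs => h (Entry.ord a :: s) I (by simpa [snoc] using hs)
    | int I => exact absurd (by simp [snoc]) (h [] I)

/-- Two sequences branch if they differ for the first time in an interval. -/
def Branch (l m : Node) : Prop :=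
  ∃ s I I', I ≠ I' ∧ snoc s I <+: l ∧ snoc s I' <+: m

theorem Branch.cons {l m : Node} (e : Entry) (h : Branch l m) : Branch (e :: l) (e :: m) := by
  obtain ⟨s, I, I', hne, h1, h2⟩ := h
  exact ⟨e :: s, I, I', hne, by simpa [snoc] using h1, by simpa [snoc] using h2⟩

theorem prefix_of_prefix_snoc {s t : Node} {I : DyadicInterval} (h : s <+: snoc t I)
    (hne : s ≠ snoc t I) : s <+: t := by
  rw [snoc, List.prefix_concat_iff] at h
  exact h.resolve_left hne

/-- If k stopped before the entry where l and m part, it would be an initial segment of l as well.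
-/
theorem Branch.of_prefix {l m k : Node} (h : Branch l m) (hk : k <+: m) (hkl : ¬ k <+: l) :
    Branch l k := by
  obtain ⟨s, I, I', hne, h1, h2⟩ := h
  refine ⟨s, I, I', hne, h1, ?_⟩
  rcases List.prefix_or_prefix_of_prefix hk h2 with h | h
  · by_cases e : k = snoc s I'
    · rw [e]
    · exact absurd ((prefix_of_prefix_snoc h e).trans ((prefix_snoc s I).trans h1)) hkl
  · exact h

theorem snoc_prefix_unique {s l : Node} {I I' : DyadicInterval} (h : snoc s I <+: l)
    (h' : snoc s I' <+: l) : I = I' := by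
  have := (List.prefix_of_prefix_length_le h h' (by simp [snoc])).eq_of_length (by simp [snoc])
  simpa [snoc] using this

theorem snoc_prefix_of_prefix {s t l : Node} {I : DyadicInterval} (h : snoc s I <+: l)
    (ht : t <+: l) (hst : s <+: t) (hne : s ≠ t) : snoc s I <+: t := by
  refine List.prefix_of_prefix_length_le h ht ?_
  have h1 := hst.length_le
  have h2 : s.length ≠ t.length := fun e => hne (hst.eq_of_length e)
  simp [snoc]; omega

/-- Every non-minimal member of a subtree has an immediate predecessor. -/
theorem exists_immediatePred {α : Ordinal.{0}} {E : Set Node} (hE : IsSubtree α E) {l : Node}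
    (hl : l ∈ E) (h : ∃ k ∈ E, k <+: l ∧ k ≠ l) :
    ∃ l₀ I, IsImmediatePred E l₀ l ∧ I.level = kappa l₀ ∧ snoc l₀ I <+: l ∧
      theta l = I.length * theta l₀ := by
  classical
  have hfin : {k | k ∈ E ∧ k <+: l ∧ k ≠ l}.Finite :=
    (l.inits.toFinset.finite_toSet).subset fun k hk => by simpa using hk.2.1
  obtain ⟨l₀, hl₀, hmax⟩ := Set.exists_max_image _ (fun k => k.length) hfin
    (by obtain ⟨k, hk⟩ := h; exact ⟨k, hk⟩)
  have hle : ∀ k ∈ E, k <+: l → k ≠ l → k <+: l₀ := fun k hk hkl hne =>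
    List.prefix_of_prefix_length_le hkl hl₀.2.1 (hmax k ⟨hk, hkl, hne⟩)
  have hlt : InTree α l := hE.1 hl
  obtain ⟨I, hI⟩ := (hlt.eq_or_snoc_prefix (hE.1 hl₀.1) hl₀.2.1).resolve_left hl₀.2.2
  refine ⟨l₀, I, ⟨hl₀, hle⟩, (hlt.of_snoc_prefix hI).2, hI, ?_⟩
  obtain ⟨r, rfl⟩ := hI
  rw [theta_append, theta_snoc, theta_eq_one (l := r), mul_one, mul_comm]
  -- An interval occurring after l₀⌢I would allow a cut in front of it, giving a member of E below l
  -- that is longer than l₀. So the rest r consists of ordinals and has weight 1.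
  intro s K hs
  obtain ⟨q, rfl⟩ := hs
  have hp : snoc (snoc l₀ I ++ s) K <+: snoc l₀ I ++ (snoc s K ++ q) := by simp [snoc]
  have ht := hlt.of_snoc_prefix hp
  have hp' := (prefix_snoc _ K).trans hp
  have := (hle _ (hE.2 _ hl _ ht.1 hp') hp' fun e => by simp [snoc] at e).length_le
  simp [snoc] at this

/-! ### Common supports under distributional embeddings -/

variable {p : ℝ≥0∞}

theorem measurable_coeFn (f : LpI p) : Measurable (f : ℝ → ℝ) := (Lp.stronglyMeasurable f).measurable

theorem measurableSet_support_coeFn (f : LpI p) : MeasurableSet (Function.support (f : ℝ → ℝ)) :=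
  measurableSet_support (measurable_coeFn f)

/-- The measure of the common support of `f` and `g`. -/
def overlap (f g : LpI p) : ℝ :=
  leb.real (Function.support (f : ℝ → ℝ) ∩ Function.support (g : ℝ → ℝ))

theorem overlap_self (f : LpI p) : overlap f f = leb.real (Function.support (f : ℝ → ℝ)) := by
  rw [overlap, inter_self]

/-- For different c these sets are disjoint, and a finite measure charges only countably many
disjoint sets. For every other c there is no cancellation in f + c g, whose support is then the
union of the two supports. -/
theorem countable_measure_pos_add_mul_eq_zero (f g : LpI p) :
    {c : ℝ | 0 < leb {t | (f : ℝ → ℝ) t + c * (g : ℝ → ℝ) t = 0 ∧ (g : ℝ → ℝ) t ≠ 0}}.Countable := by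
  have hf := measurable_coeFn f
  have hg := measurable_coeFn g
  refine Measure.countable_meas_pos_of_disjoint_iUnion (μ := leb)
    (As := fun c : ℝ => {t | (f : ℝ → ℝ) t + c * (g : ℝ → ℝ) t = 0 ∧ (g : ℝ → ℝ) t ≠ 0})
    (fun c => ?_) fun c c' hne => ?_
  · exact (measurableSet_eq_fun (hf.add (hg.const_mul c)) measurable_const).inter
      (measurableSet_eq_fun hg measurable_const).compl
  · refine Set.disjoint_left.2 fun t ht ht' => hne ?_
    have : (c - c') * (g : ℝ → ℝ) t = 0 := by linear_combination ht.1 - ht'.1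
    rcases mul_eq_zero.1 this with h | h
    · linarith
    · exact absurd h ht.2

theorem measure_support_add_smul {f g : LpI p} {c : ℝ}
    (h : leb {t | (f : ℝ → ℝ) t + c * (g : ℝ → ℝ) t = 0 ∧ (g : ℝ → ℝ) t ≠ 0} = 0) :
    leb.real (Function.support ((f + c • g : LpI p) : ℝ → ℝ)) =
      leb.real (Function.support (f : ℝ → ℝ) ∪ Function.support (g : ℝ → ℝ)) := by
  refine measureReal_congr ?_
  have h' : ∀ᵐ t ∂leb, ¬ ((f : ℝ → ℝ) t + c * (g : ℝ → ℝ) t = 0 ∧ (g : ℝ → ℝ) t ≠ 0) := by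
    rw [ae_iff]; simpa using h
  filter_upwards [h', Lp.coeFn_add f (c • g), Lp.coeFn_smul c g] with t ht h1 h2
  rw [Pi.add_apply, h2, Pi.smul_apply, smul_eq_mul] at h1
  refine propext (?_ : ((f + c • g : LpI p) : ℝ → ℝ) t ≠ 0 ↔
    (f : ℝ → ℝ) t ≠ 0 ∨ (g : ℝ → ℝ) t ≠ 0)
  rw [h1]
  by_cases hg : (g : ℝ → ℝ) t = 0
  · simp [hg]
  · simp only [hg, ne_eq, not_false_eq_true, or_true, iff_true]
    exact fun e => ht ⟨e, hg⟩

theorem measure_support_of_map_eq {f g : LpI p}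
    (h : leb.map (f : ℝ → ℝ) = leb.map (g : ℝ → ℝ)) :
    leb.real (Function.support (f : ℝ → ℝ)) = leb.real (Function.support (g : ℝ → ℝ)) := by
  have : leb.map (f : ℝ → ℝ) {0}ᶜ = leb.map (g : ℝ → ℝ) {0}ᶜ := by rw [h]
  rw [Measure.map_apply (measurable_coeFn f) (measurableSet_singleton _).compl,
    Measure.map_apply (measurable_coeFn g) (measurableSet_singleton _).compl] at this
  exact congrArg ENNReal.toReal this

theorem measure_union_support_of_map_eq {T : LpI p →ₗ[ℝ] LpI p}
    (hT : ∀ f : LpI p, leb.map (T f : ℝ → ℝ) = leb.map (f : ℝ → ℝ)) (f g : LpI p) :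
    leb.real (Function.support (T f : ℝ → ℝ) ∪ Function.support (T g : ℝ → ℝ)) =
      leb.real (Function.support (f : ℝ → ℝ) ∪ Function.support (g : ℝ → ℝ)) := by
  -- One c avoids cancellation both in f + c g and in T f + c T g = T (f + c g), which have the same
  -- distribution.
  obtain ⟨c, hc⟩ := ((countable_measure_pos_add_mul_eq_zero f g).union
    (countable_measure_pos_add_mul_eq_zero (T f) (T g))).dense_compl ℝ |>.nonempty
  simp only [compl_union, mem_inter_iff, mem_compl_iff, mem_ofPred_eq, not_lt,
    nonpos_iff_eq_zero] at hc
  rw [← measure_support_add_smul hc.1, ← measure_support_add_smul hc.2, ← map_smul, ← map_add]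
  exact measure_support_of_map_eq (hT _)

/-- Distributional embeddings preserve the measure of common supports. -/
theorem overlap_of_map_eq {T : LpI p →ₗ[ℝ] LpI p}
    (hT : ∀ f : LpI p, leb.map (T f : ℝ → ℝ) = leb.map (f : ℝ → ℝ)) (f g : LpI p) :
    overlap (T f) (T g) = overlap f g := by
  have h1 := measureReal_union_add_inter (μ := leb) (s := Function.support (T f : ℝ → ℝ))
    (measurableSet_support_coeFn (T g))
  have h2 := measureReal_union_add_inter (μ := leb) (s := Function.support (f : ℝ → ℝ))
    (measurableSet_support_coeFn g)
  have h3 := measure_union_support_of_map_eq hT f g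
  have h4 := measure_support_of_map_eq (hT f)
  have h5 := measure_support_of_map_eq (hT g)
  simp only [overlap]
  linarith

theorem overlap_of_indepFun {f g : LpI p} (h : IndepFun (f : ℝ → ℝ) (g : ℝ → ℝ) leb) :
    overlap f g = overlap f f * overlap g g := by
  have := indepFun_iff_measure_inter_preimage_eq_mul.1 h {0}ᶜ {0}ᶜ
    (measurableSet_singleton _).compl (measurableSet_singleton _).compl
  rw [overlap_self, overlap_self]
  exact (congrArg ENNReal.toReal this).trans ENNReal.toReal_mul

/-! ### Dyadic intervals and Lebesgue measure -/

theorem leb_compl_Ico : leb (Ico 0 1)ᶜ = 0 := by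
  have : (Ico (0 : ℝ) 1)ᶜ ∩ Icc 0 1 = {1} := by
    ext t; simp only [mem_inter_iff, mem_compl_iff, mem_Ico, mem_Icc, mem_singleton_iff]
    grind
  rw [leb, Measure.restrict_apply measurableSet_Ico.compl, this]
  simp

theorem leb_apply {S : Set ℝ} (hS : MeasurableSet S) : leb S = volume (S ∩ Ico 0 1) := by
  rw [leb, ← restrict_Ico_eq_restrict_Icc, Measure.restrict_apply hS]

namespace DyadicInterval

theorem mem_toSet {I : DyadicInterval} {t : ℝ} :
    t ∈ I.toSet ↔ (I.idx : ℝ) ≤ t * 2 ^ I.level ∧ t * 2 ^ I.level < I.idx + 1 := by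
  rw [toSet, mem_Ico, left, right, div_le_iff₀ (by positivity), lt_div_iff₀ (by positivity)]

theorem toSet_subset (I : DyadicInterval) : I.toSet ⊆ Ico 0 1 := by
  intro t ht
  rw [mem_toSet] at ht
  have h1 : (0 : ℝ) < 2 ^ I.level := by positivity
  have h2 : (I.idx : ℝ) + 1 ≤ 2 ^ I.level := by exact_mod_cast I.idx_lt
  have h3 : (0 : ℝ) ≤ I.idx := by positivity
  constructor
  · by_contra! h
    nlinarith
  · by_contra! h
    nlinarith

theorem disjoint_toSet {I I' : DyadicInterval} (h : I.level = I'.level) (hne : I ≠ I') :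
    Disjoint I.toSet I'.toSet := by
  refine Set.disjoint_left.2 fun t ht ht' => hne ?_
  rw [mem_toSet] at ht ht'
  rw [← h] at ht'
  have h1 : (I.idx : ℝ) < I'.idx + 1 := by linarith
  have h2 : (I'.idx : ℝ) < I.idx + 1 := by linarith
  norm_cast at h1 h2
  exact DyadicInterval.ext h (by omega)

theorem exists_mem_toSet (n : ℕ) {t : ℝ} (ht : t ∈ Ico (0 : ℝ) 1) :
    ∃ I : DyadicInterval, I.level = n ∧ t ∈ I.toSet := by
  have h0 : 0 ≤ t * 2 ^ n := mul_nonneg ht.1 (by positivity)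
  have h1 : t * 2 ^ n < 2 ^ n := by
    have : (0 : ℝ) < 2 ^ n := by positivity
    nlinarith [ht.2]
  refine ⟨⟨n, ⌊t * 2 ^ n⌋₊, (Nat.floor_lt h0).2 (by exact_mod_cast h1)⟩, rfl, ?_⟩
  rw [mem_toSet]
  exact ⟨Nat.floor_le h0, Nat.lt_floor_add_one _⟩

theorem toSet_subset_or_disjoint {P Q : DyadicInterval} (h : Q.level ≤ P.level) :
    P.toSet ⊆ Q.toSet ∨ Disjoint P.toSet Q.toSet := by
  obtain ⟨k, hk⟩ := Nat.exists_eq_add_of_le h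
  have h2 : (0 : ℝ) < 2 ^ k := by positivity
  have key : ∀ t, t ∈ Q.toSet ↔ (Q.idx : ℝ) * 2 ^ k ≤ t * 2 ^ P.level ∧
      t * 2 ^ P.level < (Q.idx + 1) * 2 ^ k := by
    intro t
    rw [mem_toSet, hk, pow_add, ← mul_assoc, mul_le_mul_iff_left₀ h2, mul_lt_mul_iff_left₀ h2]
  by_cases hc : Q.idx * 2 ^ k ≤ P.idx ∧ P.idx + 1 ≤ (Q.idx + 1) * 2 ^ k
  · left
    intro t ht
    rw [mem_toSet] at ht
    rw [key]
    have c1 : (Q.idx : ℝ) * 2 ^ k ≤ P.idx := by exact_mod_cast hc.1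
    have c2 : (P.idx : ℝ) + 1 ≤ (Q.idx + 1) * 2 ^ k := by exact_mod_cast hc.2
    exact ⟨by linarith, by linarith⟩
  · right
    refine Set.disjoint_left.2 fun t ht ht' => hc ?_
    rw [mem_toSet] at ht
    rw [key] at ht'
    have c1 : (Q.idx : ℝ) * 2 ^ k < P.idx + 1 := by linarith
    have c2 : (P.idx : ℝ) < (Q.idx + 1) * 2 ^ k := by linarith
    exact ⟨Nat.lt_succ_iff.1 (by exact_mod_cast c1), by exact_mod_cast c2⟩

theorem finite_setOf_level (n : ℕ) : {I : DyadicInterval | I.level = n}.Finite := by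
  refine (Set.finite_range fun i : Fin (2 ^ n) => (⟨n, i, i.2⟩ : DyadicInterval)).subset ?_
  rintro ⟨m, i, hi⟩ rfl
  exact ⟨⟨i, hi⟩, rfl⟩

/-- The finite set of the dyadic intervals of a given level. -/
def ofLevel (n : ℕ) : Finset DyadicInterval := (finite_setOf_level n).toFinset

theorem mem_ofLevel {n : ℕ} {I : DyadicInterval} : I ∈ ofLevel n ↔ I.level = n := by
  simp [ofLevel]

theorem leb_real_toSet (I : DyadicInterval) : leb.real I.toSet = I.length := by
  rw [length, measureReal_def, measureReal_def, leb_apply I.measurableSet_toSet,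
    inter_eq_left.2 I.toSet_subset]

theorem sum_leb_inter_toSet (n : ℕ) {S : Set ℝ} (hS : MeasurableSet S) :
    ∑ P ∈ ofLevel n, leb.real (S ∩ P.toSet) = leb.real S := by
  rw [← measureReal_biUnion_finset]
  · refine measureReal_congr ?_
    have : ∀ᵐ t ∂leb, t ∈ Ico (0 : ℝ) 1 := by rw [ae_iff]; exact leb_compl_Ico
    filter_upwards [this] with t ht
    refine propext (?_ : t ∈ (⋃ P ∈ ofLevel n, S ∩ P.toSet) ↔ t ∈ S)
    obtain ⟨I, hI, hI'⟩ := exists_mem_toSet n ht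
    simp only [mem_iUnion, mem_inter_iff, exists_prop, mem_ofLevel]
    exact ⟨fun ⟨_, _, h, _⟩ => h, fun h => ⟨I, hI, h, hI'⟩⟩
  · intro P hP Q hQ hne
    simp only [Finset.mem_coe, mem_ofLevel] at hP hQ
    exact (disjoint_toSet (hP.trans hQ.symm) hne).mono inter_subset_right inter_subset_right
  · exact fun P _ => hS.inter P.measurableSet_toSet

end DyadicInterval

/-! ### Supports under the compressions T_I -/

theorem leb_inter_preimage_affine (I : DyadicInterval) {S : Set ℝ} (hS : MeasurableSet S) :
    leb.real (I.toSet ∩ (fun t => (t - I.left) / (I.right - I.left)) ⁻¹' S) =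
      I.length * leb.real S := by
  have hd : 0 < I.right - I.left := sub_pos.2 I.left_lt_right
  have hm : Measurable fun t : ℝ => (t - I.left) / (I.right - I.left) := by fun_prop
  have key : (volume.map fun t : ℝ => (t - I.left) / (I.right - I.left)) =
      ENNReal.ofReal (I.right - I.left) • (volume : Measure ℝ) := by
    have h1 : (fun t : ℝ => (t - I.left) / (I.right - I.left)) =
        (fun t => (I.right - I.left)⁻¹ * t) ∘ fun t => t + (-I.left) := by
      funext t; simp only [Function.comp]; field_simp; ring
    rw [h1, ← Measure.map_map (by fun_prop) (by fun_prop), map_add_right_eq_self,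
      Real.map_volume_mul_left (inv_ne_zero hd.ne'), inv_inv, abs_of_pos hd]
  -- The affine map sends exactly I onto [0, 1), so intersecting with I amounts to cutting S down to
  -- [0, 1).
  have hI : (fun t : ℝ => (t - I.left) / (I.right - I.left)) ⁻¹' Ico 0 1 = I.toSet := by
    ext t
    rw [mem_preimage, mem_Ico, DyadicInterval.toSet, mem_Ico, le_div_iff₀ hd, div_lt_one hd]
    constructor <;> rintro ⟨h1, h2⟩ <;> constructor <;> linarith
  have h2 : I.toSet ∩ (fun t : ℝ => (t - I.left) / (I.right - I.left)) ⁻¹' S =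
      (fun t : ℝ => (t - I.left) / (I.right - I.left)) ⁻¹' (S ∩ Ico 0 1) := by
    rw [preimage_inter, hI, inter_comm]
  rw [measureReal_def, leb_apply (I.measurableSet_toSet.inter (hm hS)),
    inter_eq_left.2 (inter_subset_left.trans I.toSet_subset), h2,
    ← Measure.map_apply hm (hS.inter measurableSet_Ico), key, Measure.smul_apply, smul_eq_mul,
    ENNReal.toReal_mul, ENNReal.toReal_ofReal hd.le, ← leb_apply hS, I.length_eq,
    I.right_sub_left, measureReal_def]

theorem compress_coeFn (I : DyadicInterval) (f : LpI p) :
    (compress p I f : ℝ → ℝ) =ᵐ[leb] compressFun I f :=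
  MemLp.coeFn_toLp (memLp_compressFun I (Lp.memLp f))

theorem support_compress (I : DyadicInterval) (f : LpI p) :
    Function.support (compress p I f : ℝ → ℝ) =ᵐ[leb]
      (I.toSet ∩ (fun t => (t - I.left) / (I.right - I.left)) ⁻¹'
        Function.support (f : ℝ → ℝ) : Set ℝ) := by
  filter_upwards [compress_coeFn I f] with t ht
  refine propext (?_ : (compress p I f : ℝ → ℝ) t ≠ 0 ↔
    t ∈ I.toSet ∧ (f : ℝ → ℝ) ((t - I.left) / (I.right - I.left)) ≠ 0)
  rw [ht, compressFun]
  by_cases h : t ∈ I.toSet <;> simp [h]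

theorem overlap_compress (I : DyadicInterval) (f g : LpI p) :
    overlap (compress p I f) (compress p I g) = I.length * overlap f g := by
  rw [overlap, measureReal_congr ((support_compress I f).inter (support_compress I g)),
    ← inter_inter_distrib_left, ← preimage_inter,
    leb_inter_preimage_affine I
      ((measurableSet_support_coeFn f).inter (measurableSet_support_coeFn g)), overlap]

theorem overlap_compress_of_ne {I I' : DyadicInterval} (h : I.level = I'.level) (hne : I ≠ I')
    (f g : LpI p) : overlap (compress p I f) (compress p I' g) = 0 := by
  rw [overlap, measureReal_congr ((support_compress I f).inter (support_compress I' g))]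
  have : I.toSet ∩ (fun t => (t - I.left) / (I.right - I.left)) ⁻¹'
        Function.support (f : ℝ → ℝ) ∩ (I'.toSet ∩
        (fun t => (t - I'.left) / (I'.right - I'.left)) ⁻¹' Function.support (g : ℝ → ℝ)) = ∅ :=
    ((DyadicInterval.disjoint_toSet h hne).mono inter_subset_left inter_subset_left).inter_eq
  rw [this, measureReal_empty]

/-! ### Haar functions -/

theorem chi_coeFn (I : DyadicInterval) :
    (chi p I : ℝ → ℝ) =ᵐ[leb] I.toSet.indicator fun _ => 1 :=
  indicatorConstLp_coeFn

theorem haar_coeFn (I : DyadicInterval) : (haar p I : ℝ → ℝ) =ᵐ[leb]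
    fun t => I.plus.toSet.indicator (fun _ => 1) t - I.minus.toSet.indicator (fun _ => 1) t := by
  filter_upwards [Lp.coeFn_sub (chi p I.plus) (chi p I.minus), chi_coeFn (p := p) I.plus,
    chi_coeFn (p := p) I.minus] with t h1 h2 h3
  rw [haar, h1, Pi.sub_apply, h2, h3]

theorem DyadicInterval.disjoint_plus_minus (I : DyadicInterval) :
    Disjoint I.plus.toSet I.minus.toSet :=
  disjoint_toSet rfl fun h => by
    have := congrArg DyadicInterval.idx h
    simp only [plus, minus] at this
    omega

theorem DyadicInterval.eq_plus_or_minus {I : DyadicInterval} (h : 0 < I.level) :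
    I = I.parent.plus ∨ I = I.parent.minus := by
  rcases Nat.even_or_odd' I.idx with ⟨k, hk | hk⟩
  · left; ext <;> simp only [plus, parent] <;> omega
  · right; ext <;> simp only [minus, parent] <;> omega

/-- The set in question is I itself up to a null set; level 0 is excluded because there the parent
is only a default value. -/
theorem leb_haar_parent_eq_sign {I : DyadicInterval} (h : 0 < I.level) :
    leb.real {t | (haar p I.parent : ℝ → ℝ) t = I.sign} = I.length := by
  rw [← I.leb_real_toSet]
  refine measureReal_congr ?_
  filter_upwards [haar_coeFn (p := p) I.parent] with t ht
  refine propext (?_ : (haar p I.parent : ℝ → ℝ) t = I.sign ↔ t ∈ I.toSet)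
  rw [ht]
  generalize hK : I.parent = K
  have hd : t ∈ K.plus.toSet → t ∉ K.minus.toSet := fun h =>
    Set.disjoint_left.1 K.disjoint_plus_minus h
  rcases I.eq_plus_or_minus h with e | e <;> rw [hK] at e <;> subst e
  · rw [DyadicInterval.sign_plus]
    by_cases h1 : t ∈ K.plus.toSet <;> by_cases h2 : t ∈ K.minus.toSet <;> (simp_all; try norm_num)
  · rw [DyadicInterval.sign_minus]
    by_cases h1 : t ∈ K.plus.toSet <;> by_cases h2 : t ∈ K.minus.toSet <;> (simp_all; try norm_num)

/-- The interval `[0, 1)`. -/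
def DyadicInterval.unit : DyadicInterval := ⟨0, 0, by simp⟩

/-- The Haar function of `[0, 1)` does not vanish. -/
theorem support_haar_unit :
    ∀ᵐ t ∂leb, t ∈ Function.support (haar p DyadicInterval.unit : ℝ → ℝ) := by
  have : ∀ᵐ t ∂leb, t ∈ Ico (0 : ℝ) 1 := by rw [ae_iff]; exact leb_compl_Ico
  filter_upwards [haar_coeFn (p := p) DyadicInterval.unit, this] with t ht h01
  rw [Function.mem_support, ht]
  have hd : t ∈ DyadicInterval.unit.plus.toSet → t ∉ DyadicInterval.unit.minus.toSet := fun h =>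
    Set.disjoint_left.1 DyadicInterval.unit.disjoint_plus_minus h
  have hu : t ∈ DyadicInterval.unit.plus.toSet ∨ t ∈ DyadicInterval.unit.minus.toSet := by
    simp only [DyadicInterval.mem_toSet, DyadicInterval.unit, DyadicInterval.plus,
      DyadicInterval.minus]
    norm_num
    rcases lt_or_ge (t * 2) 1 with h | h
    · exact .inl ⟨by linarith [h01.1], h⟩
    · exact .inr ⟨h, by linarith [h01.2]⟩
  by_cases h1 : t ∈ DyadicInterval.unit.plus.toSet <;>
    by_cases h2 : t ∈ DyadicInterval.unit.minus.toSet <;> simp_all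

theorem overlap_haar_unit_right (f : LpI p) :
    overlap f (haar p DyadicInterval.unit) = leb.real (Function.support (f : ℝ → ℝ)) := by
  refine measureReal_congr ?_
  filter_upwards [support_haar_unit (p := p)] with t ht
  exact propext (and_iff_left ht)

theorem overlap_comm (f g : LpI p) : overlap f g = overlap g f := by
  rw [overlap, overlap, inter_comm]

theorem overlap_haar_unit_self :
    overlap (haar p DyadicInterval.unit) (haar p DyadicInterval.unit) = 1 := by
  rw [overlap_haar_unit_right]
  have : leb.real (Function.support (haar p DyadicInterval.unit : ℝ → ℝ)) = leb.real univ :=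
    measureReal_congr (by
      filter_upwards [support_haar_unit (p := p)] with t ht
      exact propext (iff_true_intro ht))
  rw [this, probReal_univ]

/-- The functions in `L_p^{n,0}` are constant on each dyadic interval of level `n`. -/
theorem exists_const_of_mem_LpZero {n : ℕ} {f : LpI p} (hf : f ∈ LpZero p n) {P : DyadicInterval}
    (hP : P.level = n) : ∃ c : ℝ, ∀ᵐ t ∂leb, t ∈ P.toSet → (f : ℝ → ℝ) t = c := by
  induction hf using Submodule.span_induction with
  | mem f hf =>
    obtain ⟨I, hI, rfl⟩ := hf
    have key : ∀ Q : DyadicInterval, Q.level ≤ P.level →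
        ∃ c : ℝ, ∀ t ∈ P.toSet, Q.toSet.indicator (fun _ => (1 : ℝ)) t = c := by
      intro Q hQ
      rcases DyadicInterval.toSet_subset_or_disjoint hQ with h | h
      · exact ⟨1, fun t ht => indicator_of_mem (h ht) _⟩
      · exact ⟨0, fun t ht => indicator_of_notMem (Set.disjoint_left.1 h ht) _⟩
    -- The halves of I have level I.level + 1 ≤ n, so neither is finer than P.
    have hI' : I.level < n := hI
    obtain ⟨c, hc⟩ := key I.plus (by rw [hP]; exact hI')
    obtain ⟨d, hd⟩ := key I.minus (by rw [hP]; exact hI')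
    refine ⟨c - d, ?_⟩
    filter_upwards [haar_coeFn (p := p) I] with t ht htP
    rw [ht, hc t htP, hd t htP]
  | zero =>
    refine ⟨0, ?_⟩
    filter_upwards [Lp.coeFn_zero ℝ p leb] with t ht _
    rw [ht, Pi.zero_apply]
  | add f g _ _ hf hg =>
    obtain ⟨c, hc⟩ := hf
    obtain ⟨d, hd⟩ := hg
    refine ⟨c + d, ?_⟩
    filter_upwards [Lp.coeFn_add f g, hc, hd] with t ht h1 h2 hP
    rw [ht, Pi.add_apply, h1 hP, h2 hP]
  | smul a f _ hf =>
    obtain ⟨c, hc⟩ := hf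
    refine ⟨a * c, ?_⟩
    filter_upwards [Lp.coeFn_smul a f, hc] with t ht h1 hP
    rw [ht, Pi.smul_apply, h1 hP, smul_eq_mul]

open Classical in
/-- The finite set underlying `dyadicAlong`. -/
def dyadicAlongFinset {m n : ℕ} (J : LpZero p m →ₗ[ℝ] LpZero p n) (I : DyadicInterval) :
    Finset DyadicInterval :=
  (DyadicInterval.ofLevel n).filter fun P => P ∈ dyadicAlong J I

theorem mem_dyadicAlongFinset {m n : ℕ} {J : LpZero p m →ₗ[ℝ] LpZero p n} {I P : DyadicInterval} :
    P ∈ dyadicAlongFinset J I ↔ P ∈ dyadicAlong J I := by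
  classical
  rw [dyadicAlongFinset, Finset.mem_filter, DyadicInterval.mem_ofLevel]
  exact and_iff_right_of_imp fun h => h.1

/-- The image of h_{π(I)} takes the value ε(I) on a set of measure |I|. Being constant on each
interval of level n, it makes that set a union of such intervals up to null sets. -/
theorem sum_length_dyadicAlong {m n : ℕ} {J : LpZero p m →ₗ[ℝ] LpZero p n}
    (hJ : IsDistEmbedding J) {I : DyadicInterval} (hI : I.level = m) (hm : 0 < m) :
    ∑ P ∈ dyadicAlongFinset J I, P.length = I.length := by
  classical
  have hI0 : 0 < I.level := hI ▸ hm
  -- This is where m > 0 enters: `haarIn` takes its true value here and not the default 0.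
  have hpar : I.parent.level < m := by simp only [DyadicInterval.parent]; omega
  set f : LpI p := (J (haarIn p m I.parent) : LpI p) with hf
  have hmeas : ∀ g : LpI p, MeasurableSet {t | (g : ℝ → ℝ) t = I.sign} := fun g =>
    measurableSet_eq_fun (measurable_coeFn g) measurable_const
  have h1 : leb.real {t | (f : ℝ → ℝ) t = I.sign} = I.length := by
    rw [← leb_haar_parent_eq_sign (p := p) hI0]
    have h2 : leb.map (f : ℝ → ℝ) {I.sign} =
        leb.map ((haarIn p m I.parent : LpI p) : ℝ → ℝ) {I.sign} := by
      rw [hf, hJ (haarIn p m I.parent)]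
    rw [Measure.map_apply (measurable_coeFn _) (measurableSet_singleton _),
      Measure.map_apply (measurable_coeFn _) (measurableSet_singleton _)] at h2
    have h3 : (haarIn p m I.parent : LpI p) = haar p I.parent := by rw [haarIn, dif_pos hpar]
    rw [h3] at h2
    exact congrArg ENNReal.toReal h2
  rw [← h1, ← DyadicInterval.sum_leb_inter_toSet n (hmeas f), dyadicAlongFinset,
    Finset.sum_filter]
  refine Finset.sum_congr rfl fun P hP => ?_
  rw [DyadicInterval.mem_ofLevel] at hP
  split_ifs with h
  · rw [← P.leb_real_toSet]
    refine measureReal_congr ?_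
    filter_upwards [h.2] with t ht
    exact propext ⟨fun h => ⟨ht h, h⟩, fun h => h.2⟩
  -- An interval outside the family carries a constant c ≠ ε(I), so it meets the set in a null set.
  · symm
    obtain ⟨c, hc⟩ := exists_const_of_mem_LpZero (J (haarIn p m I.parent)).2 hP
    have hne : c ≠ I.sign := by
      rintro rfl
      exact h ⟨hP, hc⟩
    rw [← measureReal_empty (μ := leb)]
    refine measureReal_congr ?_
    filter_upwards [hc] with t ht
    refine propext (iff_false_intro fun h => hne ?_)
    rw [← ht h.2]
    exact h.1

/-! ### The operators T_s and the supports attached to sequences -/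

/-- The factors T_β^α come from pairs of consecutive ordinals, and a cut in front of an interval
separates no such pair. -/
theorem nodeOp_append_int (U : LimitEmbeddings p) (I : DyadicInterval) (r : Node) : ∀ s : Node,
    nodeOp U (s ++ Entry.int I :: r) = nodeOp U s ∘ₗ compress p I ∘ₗ nodeOp U r
  | [] => rfl
  | [Entry.ord _] => rfl
  | Entry.ord a :: Entry.ord b :: l => by
    have := nodeOp_append_int U I r (Entry.ord b :: l)
    simp only [List.cons_append] at this
    simp only [List.cons_append, nodeOp, this, LinearMap.comp_assoc]
  | Entry.ord _ :: Entry.int K :: l => by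
    have := nodeOp_append_int U I r (Entry.int K :: l)
    simp only [List.cons_append] at this
    simp only [List.cons_append, nodeOp] at this ⊢
    exact this
  | Entry.int _ :: l => by
    have := nodeOp_append_int U I r l
    simp only [List.cons_append, nodeOp, this, LinearMap.comp_assoc]

theorem nodeOp_snoc (U : LimitEmbeddings p) (s : Node) (I : DyadicInterval) :
    nodeOp U (snoc s I) = nodeOp U s ∘ₗ compress p I := by
  rw [snoc, nodeOp_append_int]; rfl

theorem nodeOp_snoc_append (U : LimitEmbeddings p) (s r : Node) (I : DyadicInterval) :
    nodeOp U (snoc s I ++ r) = nodeOp U (snoc s I) ∘ₗ nodeOp U r := by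
  rw [nodeOp_snoc, LinearMap.comp_assoc, ← nodeOp_append_int, snoc, List.append_assoc]; rfl

theorem InTree.nodeOp_limit {U : LimitEmbeddings p} {α β : Ordinal.{0}} {l : Node}
    (hl : InTree β l) : nodeOp U (Entry.ord α :: l) = U.T α β ∘ₗ nodeOp U l := by
  obtain ⟨r, rfl⟩ := hl.exists_eq_cons
  rfl

/-- `T_s` multiplies the measure of common supports by `θ_s`. -/
def ScalesOverlap (U : LimitEmbeddings p) (s : Node) : Prop :=
  ∀ f g : LpI p, overlap (nodeOp U s f) (nodeOp U s g) = theta s * overlap f g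

theorem scalesOverlap_nil (U : LimitEmbeddings p) : ScalesOverlap U [] := fun f g => by
  simp [nodeOp, theta]

/-- Limit steps preserve overlaps and each interval I contributes |I|. Countability of α is
inherited by all ordinals met in the recursion, so the limit embeddings are available there. -/
theorem InTree.scalesOverlap {U : LimitEmbeddings p} {α : Ordinal.{0}} {l : Node}
    (h : InTree α l) (hα : α < ω₁) : ScalesOverlap U l := by
  induction h with
  | limit hlim h1 hβ hl ih =>
    intro f g
    rw [hl.nodeOp_limit, LinearMap.comp_apply, LinearMap.comp_apply,
      overlap_of_map_eq (U.dist_eq _ _ hlim hα hβ), ih (hβ.trans hα), theta]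
  | head γ => intro f g; simp [nodeOp, theta]
  | @succ α β I l hs hβ hαβ hI hl ih =>
    intro f g
    have hle : β ≤ α := by rw [hαβ]; exact le_self_add
    simp only [nodeOp, LinearMap.comp_apply]
    rw [overlap_compress, ih (hle.trans_lt hα), theta, theta, mul_assoc]

theorem ScalesOverlap.snoc {U : LimitEmbeddings p} {s : Node} (h : ScalesOverlap U s)
    (I : DyadicInterval) : ScalesOverlap U (snoc s I) := fun f g => by
  rw [nodeOp_snoc, LinearMap.comp_apply, LinearMap.comp_apply, h, overlap_compress, theta_snoc,
    mul_assoc]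

/-- The image under `T_s` of the Haar function of `[0, 1)`. -/
def nodeFun (U : LimitEmbeddings p) (s : Node) : LpI p := nodeOp U s (haar p DyadicInterval.unit)

/-- The support of `T_s h` for `h` the Haar function of `[0, 1)`. -/
def nodeSupp (U : LimitEmbeddings p) (s : Node) : Set ℝ := Function.support (nodeFun U s : ℝ → ℝ)

theorem measurableSet_nodeSupp (U : LimitEmbeddings p) (s : Node) :
    MeasurableSet (nodeSupp U s) := measurableSet_support_coeFn _

theorem overlap_nodeFun (U : LimitEmbeddings p) (s t : Node) :
    overlap (nodeFun U s) (nodeFun U t) = leb.real (nodeSupp U s ∩ nodeSupp U t) := rfl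

theorem ScalesOverlap.leb_nodeSupp {U : LimitEmbeddings p} {s : Node} (h : ScalesOverlap U s) :
    leb.real (nodeSupp U s) = theta s := by
  rw [nodeSupp, ← overlap_self, nodeFun, h, overlap_haar_unit_self, mul_one]

/-- `T_t` factors through `T_s`. -/
def FactorsThrough (U : LimitEmbeddings p) (t s : Node) : Prop :=
  ∃ R : LpI p →ₗ[ℝ] LpI p, nodeOp U t = nodeOp U s ∘ₗ R

theorem factorsThrough_nil (U : LimitEmbeddings p) (t : Node) : FactorsThrough U t [] :=
  ⟨nodeOp U t, rfl⟩

theorem factorsThrough_snoc (U : LimitEmbeddings p) {t s : Node} {I : DyadicInterval}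
    (h : snoc s I <+: t) : FactorsThrough U t (snoc s I) := by
  obtain ⟨r, rfl⟩ := h
  exact ⟨_, nodeOp_snoc_append U s r I⟩

theorem FactorsThrough.trans {U : LimitEmbeddings p} {t s r : Node} (h : FactorsThrough U t s)
    (h' : FactorsThrough U s r) : FactorsThrough U t r := by
  obtain ⟨R, hR⟩ := h
  obtain ⟨R', hR'⟩ := h'
  exact ⟨R' ∘ₗ R, by rw [hR, hR', LinearMap.comp_assoc]⟩

theorem factorsThrough_of_snoc (U : LimitEmbeddings p) (s : Node) (I : DyadicInterval) :
    FactorsThrough U (snoc s I) s := ⟨_, nodeOp_snoc U s I⟩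

theorem InTree.factorsThrough (U : LimitEmbeddings p) {α : Ordinal.{0}} {t s : Node}
    (ht : InTree α t) (hs : InTree α s) (h : s <+: t) : FactorsThrough U t s := by
  rcases ht.eq_or_snoc_prefix hs h with rfl | ⟨I, hI⟩
  · exact ⟨LinearMap.id, rfl⟩
  · exact (factorsThrough_snoc U hI).trans (factorsThrough_of_snoc U s I)

/-- Write T_t h = T_s (R h). As h has full support, R h overlaps h as much as it overlaps itself,
and T_s scales both overlaps by θ_s. -/
theorem FactorsThrough.leb_diff {U : LimitEmbeddings p} {t s : Node} (h : FactorsThrough U t s)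
    (hs : ScalesOverlap U s) : leb (nodeSupp U t \ nodeSupp U s) = 0 := by
  obtain ⟨R, hR⟩ := h
  have h1 : overlap (nodeFun U t) (nodeFun U s) = overlap (nodeFun U t) (nodeFun U t) := by
    rw [nodeFun, nodeFun, hR, LinearMap.comp_apply, hs, hs, overlap_haar_unit_right, overlap_self]
  have h2 := measureReal_sdiff_add_inter (μ := leb) (s := nodeSupp U t)
    (measurableSet_nodeSupp U s)
  rw [overlap_self] at h1
  have h3 : leb.real (nodeSupp U t ∩ nodeSupp U s) = leb.real (nodeSupp U t) := h1
  rw [← measureReal_eq_zero_iff]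
  linarith

/-- After the common part s the operators are T_I and T_{I'} for distinct intervals of the same
level κ(s), hence with disjoint ranges of supports. The tree is needed only to know these levels and
that T_s scales overlaps, so l and m may be mere initial segments of members. -/
theorem Branch.overlap_eq_zero {U : LimitEmbeddings p} {α : Ordinal.{0}} {l m : Node}
    (h : Branch l m) (hl : ∃ l', l <+: l' ∧ InTree α l') (hm : ∃ m', m <+: m' ∧ InTree α m')
    (hα : α < ω₁) : leb.real (nodeSupp U l ∩ nodeSupp U m) = 0 := by
  obtain ⟨s, I, I', hne, h1, h2⟩ := h
  obtain ⟨l', hl, hl'⟩ := hl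
  obtain ⟨m', hm, hm'⟩ := hm
  have hs := hl'.of_snoc_prefix (h1.trans hl)
  have hs' := hm'.of_snoc_prefix (h2.trans hm)
  obtain ⟨r, rfl⟩ := h1
  obtain ⟨r', rfl⟩ := h2
  rw [← overlap_nodeFun, nodeFun, nodeFun, nodeOp_snoc_append, nodeOp_snoc_append, nodeOp_snoc,
    nodeOp_snoc, LinearMap.comp_apply, LinearMap.comp_apply, LinearMap.comp_apply,
    LinearMap.comp_apply, hs.1.scalesOverlap hα,
    overlap_compress_of_ne (hs.2.trans hs'.2.symm) hne, mul_zero]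

/-- Distinct ordinals below a limit give independent functions, whose overlap is a product of
positive numbers. Equal ordinals or equal intervals reduce to the tails, distinct intervals are a
branching, and (α) alone has full support. -/
theorem InTree.overlap_pos_or_branch {U : LimitEmbeddings p} {α : Ordinal.{0}} {l : Node}
    (hl : InTree α l) (hα : α < ω₁) : ∀ {m : Node}, InTree α m →
      0 < overlap (nodeFun U l) (nodeFun U m) ∨ Branch l m := by
  have root : ∀ {α : Ordinal.{0}} (_ : α < ω₁) {m : Node}, InTree α m →
      0 < overlap (nodeFun U [Entry.ord α]) (nodeFun U m) := by
    intro α hα m hm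
    rw [overlap_comm]
    change 0 < overlap _ (haar p DyadicInterval.unit)
    rw [overlap_haar_unit_right]
    exact ((hm.scalesOverlap hα).leb_nodeSupp (U := U)).symm ▸ theta_pos m
  induction hl with
  | @limit α β l hlim h1 hβ hl ih =>
    intro m hm
    cases hm with
    | @limit _ β' m' _ h1' hβ' hm' =>
      by_cases e : β = β'
      · subst e
        refine (ih (hβ.trans hα) hm').imp (fun h => ?_) fun h => h.cons _
        rw [nodeFun, nodeFun, hl.nodeOp_limit, hm'.nodeOp_limit, LinearMap.comp_apply,
          LinearMap.comp_apply, overlap_of_map_eq (U.dist_eq _ _ hlim hα hβ)]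
        exact h
      · left
        have hs : ScalesOverlap U (Entry.ord α :: l) :=
          (InTree.limit hlim h1 hβ hl).scalesOverlap hα
        have hs' : ScalesOverlap U (Entry.ord α :: m') :=
          (InTree.limit hlim h1' hβ' hm').scalesOverlap hα
        have hi : IndepFun (nodeFun U (Entry.ord α :: l) : ℝ → ℝ)
            (nodeFun U (Entry.ord α :: m') : ℝ → ℝ) leb := by
          classical
          have := (U.indep α hlim hα fun γ => if γ.1 = β then nodeFun U l else nodeFun U m').indepFun
            (i := ⟨β, hβ⟩) (j := ⟨β', hβ'⟩) (fun h => e (congrArg Subtype.val h))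
          simp only [if_true, if_neg (Ne.symm e)] at this
          rw [nodeFun, nodeFun, hl.nodeOp_limit, hm'.nodeOp_limit]
          exact this
        rw [overlap_of_indepFun hi, overlap_self, overlap_self]
        exact mul_pos (hs.leb_nodeSupp.symm ▸ theta_pos _) (hs'.leb_nodeSupp.symm ▸ theta_pos _)
    | head γ => exact absurd hlim (not_isSuccLimit_add_one γ)
    | succ hα' =>
      obtain ⟨γ, rfl⟩ := hα'
      exact absurd hlim (not_isSuccLimit_add_one γ)
  | head γ => exact fun {m} hm => .inl (root hα hm)
  | @succ α β I l hs hβ hαβ hI hl ih =>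
    intro m hm
    cases hm with
    | limit hα' =>
      obtain ⟨γ, rfl⟩ := hs
      exact absurd hα' (not_isSuccLimit_add_one γ)
    | head γ =>
      left
      rw [overlap_comm]
      exact root hα (InTree.succ hs hβ hαβ hI hl)
    | @succ _ β' I' m' _ hβ' hαβ' hI' hm' =>
      by_cases hII : I = I'
      · subst hII
        -- Cancellation on the right is legitimate for ordinals here because κ(α) is finite.
        have e : β' = β := by
          have := hαβ'.symm.trans hαβ
          exact Ordinal.add_right_cancel _ |>.1 this
        subst e
        have hle : β' ≤ α := by rw [hαβ]; exact le_self_add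
        refine (ih (hle.trans_lt hα) hm').imp (fun h => ?_) fun h => (h.cons _).cons _
        change 0 < overlap (compress p I (nodeFun U l)) (compress p I (nodeFun U m'))
        rw [overlap_compress]
        exact mul_pos I.length_pos h
      · right
        exact ⟨[Entry.ord α], I, I', hII, by simp [snoc], by simp [snoc]⟩

theorem haar_unit_mem_LpZero {n : ℕ} (hn : 0 < n) : haar p DyadicInterval.unit ∈ LpZero p n :=
  Submodule.subset_span ⟨_, hn, rfl⟩

theorem DisjointlySupported.leb_eq_zero {U : LimitEmbeddings p} {l m : Node}
    (h : DisjointlySupported U l m) (hl : 0 < kappa l) (hm : 0 < kappa m) :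
    leb.real (nodeSupp U l ∩ nodeSupp U m) = 0 := by
  obtain ⟨A, B, hA, hB, hAB⟩ := h
  have h1 := hA.2.1 (nodeFun U l) ⟨_, haar_unit_mem_LpZero hl, rfl⟩
  have h2 := hB.2.1 (nodeFun U m) ⟨_, haar_unit_mem_LpZero hm, rfl⟩
  rw [measureReal_eq_zero_iff]
  refine measure_mono_null_ae ?_ hAB
  filter_upwards [h1, h2] with t h1 h2 ht
  exact ⟨h1 ht.1, h2 ht.2⟩

/-! ### Families of almost disjoint sets -/

theorem sum_measureReal_le {ι : Type*} {M : Finset ι} {A : ι → Set ℝ} {B : Set ℝ}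
    (hA : ∀ i, MeasurableSet (A i))
    (hd : ∀ i ∈ M, ∀ j ∈ M, i ≠ j → leb.real (A i ∩ A j) = 0)
    (hAB : ∀ i ∈ M, leb (A i \ B) = 0) : ∑ i ∈ M, leb.real (A i) ≤ leb.real B := by
  rw [← measureReal_biUnion_finset₀ (fun i hi j hj hij => by
    have := hd i hi j hj hij
    rwa [measureReal_eq_zero_iff] at this) fun i _ => (hA i).nullMeasurableSet]
  refine ENNReal.toReal_mono (measure_ne_top leb B) (measure_mono_ae ?_)
  have : ∀ᵐ t ∂leb, ∀ i ∈ M, ¬ t ∈ A i \ B := by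
    rw [Filter.eventually_all_finset]
    intro i hi
    exact measure_mono_null (fun t ht => not_not.1 ht) (hAB i hi)
  filter_upwards [this] with t ht htA
  obtain ⟨i, hi, hti⟩ := mem_iUnion₂.1 htA
  by_contra hB
  exact ht i hi ⟨hti, hB⟩

/-- If almost disjoint sets fill `B`, the measure of a subset of `B` is the sum of the measures of
its traces. -/
theorem measureReal_eq_sum_inter {ι : Type*} {M : Finset ι} {A : ι → Set ℝ} {B C : Set ℝ}
    (hA : ∀ i, MeasurableSet (A i)) (hC : MeasurableSet C) (hB : MeasurableSet B)
    (hd : ∀ i ∈ M, ∀ j ∈ M, i ≠ j → leb.real (A i ∩ A j) = 0)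
    (hAB : ∀ i ∈ M, leb (A i \ B) = 0) (hCB : leb (C \ B) = 0)
    (hsum : ∑ i ∈ M, leb.real (A i) = leb.real B) :
    leb.real C = ∑ i ∈ M, leb.real (C ∩ A i) := by
  refine le_antisymm ?_ (sum_measureReal_le (fun i => hC.inter (hA i)) (fun i hi j hj hij => ?_)
    fun i hi => ?_)
  -- The parts of the A_i outside C have total mass at most |B \ C|. Since the A_i have mass |B|,
  -- their traces on C must account for all of C.
  · have h1 : ∑ i ∈ M, leb.real (A i \ C) ≤ leb.real (B \ C) :=
      sum_measureReal_le (fun i => (hA i).diff hC) (fun i hi j hj hij =>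
        measureReal_mono_null (inter_subset_inter sdiff_subset sdiff_subset) (hd i hi j hj hij))
        fun i hi => measure_mono_null (fun t (ht : t ∈ (A i \ C) \ (B \ C)) =>
          (⟨ht.1.1, fun h => ht.2 ⟨h, ht.1.2⟩⟩ : t ∈ A i \ B)) (hAB i hi)
    have h2 : ∑ i ∈ M, leb.real (A i) =
        ∑ i ∈ M, leb.real (C ∩ A i) + ∑ i ∈ M, leb.real (A i \ C) := by
      rw [← Finset.sum_add_distrib]
      refine Finset.sum_congr rfl fun i _ => ?_
      rw [inter_comm, measureReal_inter_add_sdiff hC]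
    have h3 := measureReal_inter_add_sdiff (μ := leb) (s := B) hC
    have h4 := measureReal_inter_add_sdiff (μ := leb) (s := C) hB
    have h5 : leb.real (C \ B) = 0 := (measureReal_eq_zero_iff).2 hCB
    rw [inter_comm] at h4
    linarith
  · exact measureReal_mono_null (inter_subset_inter inter_subset_right inter_subset_right)
      (hd i hi j hj hij)
  · rw [sdiff_eq_empty.2 inter_subset_left, measure_empty]

theorem Branch.not_prefix {l m : Node} (h : Branch l m) : ¬ l <+: m := by
  obtain ⟨s, I, I', hne, h1, h2⟩ := h
  exact fun h => hne (snoc_prefix_unique (h1.trans h) h2)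

/-! ### Masses of extensions in a distributional embedding scheme -/

namespace DES

variable {U : LimitEmbeddings p} {E F : Set Node} (Ψ : DES U E F) {α β : Ordinal.{0}}

theorem mem_Gamma {l s ν : Node} : ν ∈ Ψ.Gamma l s ↔ ν ∈ Ψ.M l ∧ s <+: ν := by
  classical
  rw [Gamma, Finset.mem_filter]

variable {Ψ} in
theorem leb_inter_eq_zero (hF : F ⊆ tree β) {l m m' : Node} (hl : l ∈ E) (hm : m ∈ Ψ.M l)
    (hm' : m' ∈ Ψ.M l) (hne : m ≠ m') : leb.real (nodeSupp U m ∩ nodeSupp U m') = 0 :=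
  (Ψ.disjoint l hl m hm m' hm' hne).leb_eq_zero
    (InTree.kappa_pos (hF (Ψ.M_subset l hl m hm))) (InTree.kappa_pos (hF (Ψ.M_subset l hl m' hm')))

variable {Ψ} in
-- Disjoint supports rule out positive overlap, so branching at an interval is the only alternative.
theorem branch (hF : F ⊆ tree β) (hβ : β < ω₁) {l m m' : Node} (hl : l ∈ E) (hm : m ∈ Ψ.M l)
    (hm' : m' ∈ Ψ.M l) (hne : m ≠ m') : Branch m m' :=
  (InTree.overlap_pos_or_branch (U := U) (hF (Ψ.M_subset l hl m hm)) hβ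
    (hF (Ψ.M_subset l hl m' hm'))).resolve_left
    ((leb_inter_eq_zero hF hl hm hm' hne).le.not_gt)

theorem leb_nodeSupp_of_mem (hF : F ⊆ tree β) (hβ : β < ω₁) {l m : Node} (hl : l ∈ E)
    (hm : m ∈ Ψ.M l) : leb.real (nodeSupp U m) = theta m :=
  ((InTree.scalesOverlap (hF (Ψ.M_subset l hl m hm)) hβ) : ScalesOverlap U m).leb_nodeSupp

theorem sum_Gamma_le (hF : F ⊆ tree β) (hβ : β < ω₁) {l s : Node} (hl : l ∈ E)
    (hs : ScalesOverlap U s) (hfac : ∀ ν ∈ Ψ.M l, s <+: ν → FactorsThrough U ν s) :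
    ∑ ν ∈ Ψ.Gamma l s, theta ν ≤ theta s := by
  rw [← hs.leb_nodeSupp, ← Finset.sum_congr rfl fun ν hν =>
    Ψ.leb_nodeSupp_of_mem hF hβ hl (Ψ.mem_Gamma.1 hν).1]
  refine sum_measureReal_le (measurableSet_nodeSupp U) (fun m hm m' hm' => ?_) fun m hm => ?_
  · exact leb_inter_eq_zero hF hl (Ψ.mem_Gamma.1 hm).1 (Ψ.mem_Gamma.1 hm').1
  · exact (hfac m (Ψ.mem_Gamma.1 hm).1 (Ψ.mem_Gamma.1 hm).2).leb_diff hs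

/-- If the extensions of `s` in `M_l` have full mass, then so have those of `t ⊒ s`, provided
that the others are disjoint from `t`. -/
theorem sum_Gamma_eq_of_sum_Gamma_eq (hF : F ⊆ tree β) (hβ : β < ω₁) {l s t : Node} (hl : l ∈ E)
    (hs : ScalesOverlap U s) (ht : ScalesOverlap U t) (hst : s <+: t)
    (hts : FactorsThrough U t s) (hfac : ∀ ν ∈ Ψ.M l, t <+: ν → FactorsThrough U ν t)
    (hfac' : ∀ ν ∈ Ψ.M l, s <+: ν → FactorsThrough U ν s)
    (hsum : ∑ ν ∈ Ψ.Gamma l s, theta ν = theta s)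
    (hdis : ∀ ν ∈ Ψ.M l, s <+: ν → t <+: ν ∨ leb.real (nodeSupp U ν ∩ nodeSupp U t) = 0) :
    ∑ ν ∈ Ψ.Gamma l t, theta ν = theta t := by
  classical
  have key := measureReal_eq_sum_inter (M := Ψ.Gamma l s) (A := nodeSupp U) (B := nodeSupp U s)
    (C := nodeSupp U t) (measurableSet_nodeSupp U) (measurableSet_nodeSupp U t)
    (measurableSet_nodeSupp U s)
    (fun m hm m' hm' => leb_inter_eq_zero hF hl (Ψ.mem_Gamma.1 hm).1 (Ψ.mem_Gamma.1 hm').1)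
    (fun m hm => (hfac' m (Ψ.mem_Gamma.1 hm).1 (Ψ.mem_Gamma.1 hm).2).leb_diff hs)
    (hts.leb_diff hs)
    (by
      rw [hs.leb_nodeSupp, ← hsum]
      exact Finset.sum_congr rfl fun ν hν =>
        Ψ.leb_nodeSupp_of_mem hF hβ hl (Ψ.mem_Gamma.1 hν).1)
  rw [← ht.leb_nodeSupp, key]
  have hsub : Ψ.Gamma l t ⊆ Ψ.Gamma l s := fun ν hν =>
    Ψ.mem_Gamma.2 ⟨(Ψ.mem_Gamma.1 hν).1, hst.trans (Ψ.mem_Gamma.1 hν).2⟩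
  -- Members extending t lie inside its support and contribute their full weight; the remaining ones
  -- have null trace.
  rw [← Finset.sum_subset hsub]
  · refine Finset.sum_congr rfl fun ν hν => ?_
    have h := Ψ.mem_Gamma.1 hν
    rw [← Ψ.leb_nodeSupp_of_mem hF hβ hl h.1, inter_comm,
      ← measureReal_sdiff_add_inter (μ := leb) (s := nodeSupp U ν) (measurableSet_nodeSupp U t),
      (measureReal_eq_zero_iff).2 ((hfac ν h.1 h.2).leb_diff ht), zero_add]
  · intro ν hν hν'
    rw [Ψ.mem_Gamma] at hν hν'
    rw [inter_comm]
    exact (hdis ν hν.1 hν.2).resolve_left fun h => hν' ⟨hν.1, h⟩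

/-- The pairs `(μ, P)` with `μ ∈ M_l` and `P ∈ 𝓓_I^{κ(μ)}`. -/
def pairs (l : Node) (I : DyadicInterval) : Finset (Σ _ : Node, DyadicInterval) :=
  (Ψ.M l).sigma fun μ => dyadicAlongFinset (Ψ.J l μ) I

theorem mem_pairs {l : Node} {I : DyadicInterval} {x : Σ _ : Node, DyadicInterval} :
    x ∈ Ψ.pairs l I ↔ x.1 ∈ Ψ.M l ∧ x.2 ∈ dyadicAlong (Ψ.J l x.1) I := by
  rw [pairs, Finset.mem_sigma, mem_dyadicAlongFinset]

theorem sum_pairs (hE : E ⊆ tree α) {l : Node} (hl : l ∈ E) {I : DyadicInterval}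
    (hI : I.level = kappa l) {s : Finset Node} (hs : s ⊆ Ψ.M l) :
    ∑ x ∈ s.sigma fun μ => dyadicAlongFinset (Ψ.J l μ) I, theta (snoc x.1 x.2) =
      I.length * ∑ μ ∈ s, theta μ := by
  rw [Finset.sum_sigma, Finset.mul_sum]
  refine Finset.sum_congr rfl fun μ hμ => ?_
  simp only [theta_snoc]
  rw [← Finset.mul_sum, sum_length_dyadicAlong (Ψ.J_dist l hl μ (hs hμ)) hI
    (InTree.kappa_pos (hE hl)), mul_comm]

theorem sum_Gamma_snoc_le (hF : F ⊆ tree β) (hβ : β < ω₁) {l : Node} (hl : l ∈ E) {μ : Node}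
    (hμ : InTree β μ) (P : DyadicInterval) :
    ∑ ν ∈ Ψ.Gamma l (snoc μ P), theta ν ≤ theta (snoc μ P) :=
  Ψ.sum_Gamma_le hF hβ hl ((hμ.scalesOverlap hβ).snoc P) fun _ _ h => factorsThrough_snoc U h

/-- A part of `M_l` is dominated by any set of pairs of the preceding level that it extends. -/
theorem sum_le_sum_pairs {l : Node} {s : Finset Node} (hs : s ⊆ Ψ.M l)
    {q : Finset (Σ _ : Node, DyadicInterval)}
    (h : ∀ ν ∈ s, ∃ x ∈ q, snoc x.1 x.2 <+: ν) :
    ∑ ν ∈ s, theta ν ≤ ∑ x ∈ q, ∑ ν ∈ Ψ.Gamma l (snoc x.1 x.2), theta ν := by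
  classical
  have h1 : ∀ x ∈ q, ∑ ν ∈ s, (if snoc x.1 x.2 <+: ν then theta ν else 0) ≤
      ∑ ν ∈ Ψ.Gamma l (snoc x.1 x.2), theta ν := by
    intro x _
    rw [← Finset.sum_filter]
    refine Finset.sum_le_sum_of_subset_of_nonneg (fun ν hν => ?_) fun ν _ _ => (theta_pos ν).le
    rw [Finset.mem_filter] at hν
    exact Ψ.mem_Gamma.2 ⟨hs hν.1, hν.2⟩
  refine le_trans ?_ (Finset.sum_le_sum h1)
  rw [Finset.sum_comm]
  refine Finset.sum_le_sum fun ν hν => ?_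
  obtain ⟨x, hx, hxν⟩ := h ν hν
  refine le_trans ?_ (Finset.single_le_sum (fun y _ => ?_) hx)
  · rw [if_pos hxν]
  · split_ifs
    exacts [(theta_pos ν).le, le_rfl]

section Step

variable {l₀ l : Node} {I : DyadicInterval}

theorem exists_pair (hl : l ∈ E) (hpred : IsImmediatePred E l₀ l) (hI : I.level = kappa l₀)
    (hIl : snoc l₀ I <+: l) {ν : Node} (hν : ν ∈ Ψ.M l) :
    ∃ x ∈ Ψ.pairs l₀ I, snoc x.1 x.2 <+: ν := by
  obtain ⟨μ, hμ, P, hP, h⟩ := Ψ.along l hl l₀ hpred I hI hIl ν hν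
  exact ⟨⟨μ, P⟩, Ψ.mem_pairs.2 ⟨hμ, hP⟩, h⟩

/-- Every `μ⌢P` with `μ ∈ M_{l₀}` and `P ∈ 𝓓_I^{κ(μ)}` is filled by its extensions in `M_l`. -/
theorem sum_Gamma_snoc_eq (hE : E ⊆ tree α) (hF : F ⊆ tree β) (hβ : β < ω₁) (hl : l ∈ E)
    (hpred : IsImmediatePred E l₀ l) (hI : I.level = kappa l₀) (hIl : snoc l₀ I <+: l)
    (hθ : theta l = I.length * theta l₀) {μ : Node} {P : DyadicInterval} (hμ : μ ∈ Ψ.M l₀)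
    (hP : P ∈ dyadicAlong (Ψ.J l₀ μ) I) :
    ∑ ν ∈ Ψ.Gamma l (snoc μ P), theta ν = theta (snoc μ P) := by
  have hl₀ := hpred.1.1
  have htree : ∀ x ∈ Ψ.pairs l₀ I, InTree β x.1 := fun x hx =>
    hF (Ψ.M_subset l₀ hl₀ _ (Ψ.mem_pairs.1 hx).1)
  have hle : ∀ x ∈ Ψ.pairs l₀ I,
      ∑ ν ∈ Ψ.Gamma l (snoc x.1 x.2), theta ν ≤ theta (snoc x.1 x.2) := fun x hx =>
    Ψ.sum_Gamma_snoc_le hF hβ hl (htree x hx) x.2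
  have h1 := Ψ.sum_le_sum_pairs Finset.Subset.rfl fun ν hν =>
    Ψ.exists_pair hl hpred hI hIl hν
  have h2 : ∑ x ∈ Ψ.pairs l₀ I, theta (snoc x.1 x.2) = I.length * theta l₀ := by
    rw [pairs, Ψ.sum_pairs hE hl₀ hI Finset.Subset.rfl, Ψ.sum_theta l₀ hl₀]
  have h3 := Ψ.sum_theta l hl
  -- The chain θ_l ≤ Σ (mass above μ⌢P) ≤ Σ θ_{μ⌢P} = |I| θ_{l₀} = θ_l closes up, so every termwise
  -- inequality is an equality.
  exact (Finset.sum_eq_sum_iff_of_le hle).1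
    (le_antisymm (Finset.sum_le_sum hle) (by linarith)) ⟨μ, P⟩ (Ψ.mem_pairs.2 ⟨hμ, hP⟩)

theorem sum_le_length_mul_sum (hE : E ⊆ tree α) (hF : F ⊆ tree β) (hβ : β < ω₁) (hl : l ∈ E)
    (hpred : IsImmediatePred E l₀ l) (hI : I.level = kappa l₀) (hIl : snoc l₀ I <+: l)
    {s s₀ : Finset Node} (hs : s ⊆ Ψ.M l) (hs₀ : s₀ ⊆ Ψ.M l₀)
    (h : ∀ ν ∈ s, ∀ μ ∈ Ψ.M l₀, ∀ P, snoc μ P <+: ν → μ ∈ s₀) :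
    ∑ ν ∈ s, theta ν ≤ I.length * ∑ μ ∈ s₀, theta μ := by
  have hl₀ := hpred.1.1
  rw [← Ψ.sum_pairs hE hl₀ hI hs₀]
  have htree : ∀ x ∈ s₀.sigma fun μ => dyadicAlongFinset (Ψ.J l₀ μ) I, InTree β x.1 :=
    fun x hx => hF (Ψ.M_subset l₀ hl₀ _ (hs₀ (Finset.mem_sigma.1 hx).1))
  refine (Ψ.sum_le_sum_pairs hs fun ν hν => ?_).trans
    (Finset.sum_le_sum fun x hx => Ψ.sum_Gamma_snoc_le hF hβ hl (htree x hx) x.2)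
  obtain ⟨x, hx, hxν⟩ := Ψ.exists_pair hl hpred hI hIl (hs hν)
  rw [mem_pairs] at hx
  exact ⟨x, Finset.mem_sigma.2 ⟨h ν hν x.1 hx.1 x.2 hxν, mem_dyadicAlongFinset.2 hx.2⟩, hxν⟩

/-- The upper bound holds for the members extending s and for those that do not. The two bounds add
up to θ_l = |I| θ_{l₀}, so both are sharp. -/
theorem sum_Gamma_step (hE : E ⊆ tree α) (hF : F ⊆ tree β) (hβ : β < ω₁) (hl : l ∈ E)
    (hpred : IsImmediatePred E l₀ l) (hI : I.level = kappa l₀) (hIl : snoc l₀ I <+: l)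
    (hθ : theta l = I.length * theta l₀) {s : Node} (hne : (Ψ.Gamma l₀ s).Nonempty) :
    ∑ ν ∈ Ψ.Gamma l s, theta ν = I.length * ∑ ν ∈ Ψ.Gamma l₀ s, theta ν := by
  classical
  have hl₀ := hpred.1.1
  have h1 := Ψ.sum_le_length_mul_sum hE hF hβ hl hpred hI hIl (s := Ψ.Gamma l s)
    (s₀ := Ψ.Gamma l₀ s) (Finset.filter_subset _ _) (Finset.filter_subset _ _) (by
      intro ν hν μ hμ P hP
      rw [mem_Gamma] at hν
      refine Ψ.mem_Gamma.2 ⟨hμ, ?_⟩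
      rcases List.prefix_or_prefix_of_prefix hν.2 ((prefix_snoc μ P).trans hP) with h | h
      · exact h
      -- Nonemptiness excludes μ being a proper initial segment of s: it would then lie below μ' ∈
      -- M_{l₀}, whereas distinct members of M_{l₀} branch.
      · obtain ⟨μ', hμ'⟩ := hne
        rw [mem_Gamma] at hμ'
        by_cases e : μ = μ'
        · exact e ▸ hμ'.2
        · exact absurd (h.trans hμ'.2) (branch hF hβ hl₀ hμ hμ'.1 e).not_prefix)
  have h2 := Ψ.sum_le_length_mul_sum hE hF hβ hl hpred hI hIl
    (s := (Ψ.M l).filter fun ν => ¬ s <+: ν) (s₀ := (Ψ.M l₀).filter fun ν => ¬ s <+: ν)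
    (Finset.filter_subset _ _) (Finset.filter_subset _ _) (by
      intro ν hν μ hμ P hP
      rw [Finset.mem_filter] at hν ⊢
      exact ⟨hμ, fun h => hν.2 (h.trans ((prefix_snoc μ P).trans hP))⟩)
  have h3 := Finset.sum_filter_add_sum_filter_not (Ψ.M l) (fun ν => s <+: ν) theta
  have h4 := Finset.sum_filter_add_sum_filter_not (Ψ.M l₀) (fun ν => s <+: ν) theta
  rw [Ψ.sum_theta l hl] at h3
  rw [Ψ.sum_theta l₀ hl₀] at h4
  have h5 : ∑ ν ∈ Ψ.Gamma l s, theta ν = ∑ ν ∈ (Ψ.M l).filter fun ν => s <+: ν, theta ν :=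
    Finset.sum_congr (by ext; simp [mem_Gamma]) fun _ _ => rfl
  have h6 : ∑ ν ∈ Ψ.Gamma l₀ s, theta ν = ∑ ν ∈ (Ψ.M l₀).filter fun ν => s <+: ν, theta ν :=
    Finset.sum_congr (by ext; simp [mem_Gamma]) fun _ _ => rfl
  have h7 : I.length * theta l₀ = I.length * ∑ ν ∈ Ψ.Gamma l₀ s, theta ν +
      I.length * ∑ ν ∈ (Ψ.M l₀).filter fun ν => ¬ s <+: ν, theta ν := by
    rw [← h4, ← mul_add, h6]
  linarith

end Step

theorem Gamma_nonempty_of_sum_pos {l s : Node} (h : 0 < ∑ ν ∈ Ψ.Gamma l s, theta ν) :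
    (Ψ.Gamma l s).Nonempty := by
  by_contra hne
  rw [Finset.not_nonempty_iff_eq_empty.1 hne, Finset.sum_empty] at h
  exact lt_irrefl _ h

/-- The relative mass of the extensions of `s` does not change beyond the first nodes after `k`. -/
theorem sum_Gamma_eq_mul (hE : IsSubtree α E) (hF : F ⊆ tree β) (hβ : β < ω₁) {k s : Node}
    {c : ℝ} (hc : 0 < c)
    (hbase : ∀ l ∈ E, k <+: l → (∀ l' ∈ E, k <+: l' → l' <+: l → l' = l) →
      ∑ ν ∈ Ψ.Gamma l s, theta ν = c * theta l) :
    ∀ l ∈ E, k <+: l → ∑ ν ∈ Ψ.Gamma l s, theta ν = c * theta l := by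
  suffices ∀ n, ∀ l ∈ E, l.length = n → k <+: l → ∑ ν ∈ Ψ.Gamma l s, theta ν = c * theta l from
    fun l hl => this _ l hl rfl
  intro n
  induction n using Nat.strong_induction_on with
  | _ n ih =>
    intro l hl hn hkl
    by_cases hex : ∃ l' ∈ E, k <+: l' ∧ l' <+: l ∧ l' ≠ l
    · obtain ⟨l', hl', hkl', hl'l, hne⟩ := hex
      obtain ⟨l₁, I, hpred, hI, hIl, hθ⟩ := exists_immediatePred hE hl ⟨l', hl', hl'l, hne⟩
      have hlt : l₁.length < n := by
        have h1 := hpred.1.2.1.length_le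
        have h2 : l₁.length ≠ l.length := fun e =>
          hpred.1.2.2 (hpred.1.2.1.eq_of_length e)
        omega
      have h1 := ih _ hlt l₁ hpred.1.1 rfl (hkl'.trans (hpred.2 l' hl' hl'l hne))
      -- Positivity of c supplies the nonemptiness that the step from l₁ to l requires.
      have hne : (Ψ.Gamma l₁ s).Nonempty :=
        Ψ.Gamma_nonempty_of_sum_pos (by rw [h1]; exact mul_pos hc (theta_pos _))
      rw [Ψ.sum_Gamma_step hE.1 hF hβ hl hpred hI hIl hθ hne, h1, hθ]
      ring
    · push Not at hex
      exact hbase l hl hkl hex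

/-- At the first node `l₀` where `μ₀` has extensions, they fill `μ₀`. -/
theorem sum_Gamma_eq_theta (hE : IsSubtree α E) (hF : F ⊆ tree β) (hβ : β < ω₁) {μ₀ l₀ : Node}
    (hμ₀ : μ₀ ∈ F) (hl₀ : l₀ ∈ E) (hne : (Ψ.Gamma l₀ μ₀).Nonempty)
    (hmin : ∀ l ∈ E, l <+: l₀ → (Ψ.Gamma l μ₀).Nonempty → l = l₀) :
    ∑ ν ∈ Ψ.Gamma l₀ μ₀, theta ν = theta μ₀ := by
  obtain ⟨ν₀, hν₀⟩ := hne
  rw [mem_Gamma] at hν₀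
  have hμt : InTree β μ₀ := hF hμ₀
  have htree : ∀ ν ∈ Ψ.M l₀, InTree β ν := fun ν hν => hF (Ψ.M_subset l₀ hl₀ ν hν)
  have hdis : ∀ ν ∈ Ψ.M l₀, μ₀ <+: ν ∨ leb.real (nodeSupp U ν ∩ nodeSupp U μ₀) = 0 := by
    intro ν hν
    by_cases h : μ₀ <+: ν
    · exact .inl h
    · right
      -- A member not extending μ₀ branches off from ν₀ ⊒ μ₀, and it does so already within μ₀.
      have hb : Branch ν ν₀ := branch hF hβ hl₀ hν hν₀.1 fun e => h (e ▸ hν₀.2)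
      exact (hb.of_prefix hν₀.2 h).overlap_eq_zero ⟨ν, List.prefix_rfl, htree ν hν⟩
        ⟨μ₀, List.prefix_rfl, hμt⟩ hβ
  by_cases hex : ∃ k ∈ E, k <+: l₀ ∧ k ≠ l₀
  · obtain ⟨l₁, I, hpred, hI, hIl, hθ⟩ := exists_immediatePred hE hl₀ hex
    obtain ⟨⟨μ, P⟩, hx, hxν⟩ := Ψ.exists_pair hl₀ hpred hI hIl hν₀.1
    rw [mem_pairs] at hx
    have hsum := Ψ.sum_Gamma_snoc_eq hE.1 hF hβ hl₀ hpred hI hIl hθ hx.1 hx.2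
    have hnot : ¬ μ₀ <+: μ := fun h =>
      hpred.1.2.2 (hmin l₁ hpred.1.1 hpred.1.2.1 ⟨μ, Ψ.mem_Gamma.2 ⟨hx.1, h⟩⟩)
    have hμ : InTree β μ := hF (Ψ.M_subset l₁ hpred.1.1 μ hx.1)
    -- Both sequences are initial segments of ν₀, and minimality of l₀ prevents μ from extending μ₀.
    have hpre : snoc μ P <+: μ₀ := by
      rcases List.prefix_or_prefix_of_prefix hν₀.2 ((prefix_snoc μ P).trans hxν) with h | h
      · exact absurd h hnot
      · exact snoc_prefix_of_prefix hxν hν₀.2 h fun e => hnot (e ▸ List.prefix_rfl)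
    exact Ψ.sum_Gamma_eq_of_sum_Gamma_eq hF hβ hl₀ ((hμ.scalesOverlap hβ).snoc P)
      (hμt.scalesOverlap hβ) hpre (factorsThrough_snoc U hpre)
      (fun ν hν h => (htree ν hν).factorsThrough U hμt h) (fun ν _ h => factorsThrough_snoc U h)
      hsum fun ν hν _ => hdis ν hν
  -- Without predecessors in E, l₀ contains no interval; the empty sequence, with T = id and weight
  -- 1, then plays the role of μ⌢P.
  · have hθ : theta l₀ = 1 := theta_eq_one fun s I hs => by
      have h1 := InTree.of_snoc_prefix (hE.1 hl₀) hs
      have h2 := (prefix_snoc s I).trans hs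
      refine hex ⟨s, hE.2 _ hl₀ s h1.1 h2, h2, ?_⟩
      rintro rfl
      simpa [snoc] using hs.length_le
    refine Ψ.sum_Gamma_eq_of_sum_Gamma_eq hF hβ hl₀ (scalesOverlap_nil U)
      (hμt.scalesOverlap hβ) List.nil_prefix (factorsThrough_nil U _)
      (fun ν hν h => (htree ν hν).factorsThrough U hμt h) (fun ν _ _ => factorsThrough_nil U ν)
      ?_ fun ν hν _ => hdis ν hν
    have : Ψ.Gamma l₀ [] = Ψ.M l₀ := by ext; simp [mem_Gamma]
    rw [this, Ψ.sum_theta l₀ hl₀, hθ, theta]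

/-- If `μ₀ ∉ M_{l₀}` is filled by its extensions in `M_{l₀}`, then so is `μ₀⌢J`. -/
theorem sum_Gamma_snoc_eq_theta (hF : F ⊆ tree β) (hβ : β < ω₁) {μ₀ l₀ : Node}
    (hμ₀ : μ₀ ∈ F) (hl₀ : l₀ ∈ E) (hsum : ∑ ν ∈ Ψ.Gamma l₀ μ₀, theta ν = theta μ₀)
    (hnot : μ₀ ∉ Ψ.M l₀) {J : DyadicInterval} (hJ : J.level = kappa μ₀) :
    ∑ ν ∈ Ψ.Gamma l₀ (snoc μ₀ J), theta ν = theta (snoc μ₀ J) := by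
  have hμt : InTree β μ₀ := hF hμ₀
  have htree : ∀ ν ∈ Ψ.M l₀, InTree β ν := fun ν hν => hF (Ψ.M_subset l₀ hl₀ ν hν)
  refine Ψ.sum_Gamma_eq_of_sum_Gamma_eq hF hβ hl₀ (hμt.scalesOverlap hβ)
    ((hμt.scalesOverlap hβ).snoc J) (prefix_snoc μ₀ J) (factorsThrough_of_snoc U μ₀ J)
    (fun ν _ h => factorsThrough_snoc U h) (fun ν hν h => (htree ν hν).factorsThrough U hμt h)
    hsum fun ν hν h => ?_
  -- As μ₀ itself is not in M_{l₀}, every member extending it continues with an interval K of the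
  -- same level as J.
  obtain ⟨K, hK⟩ := ((htree ν hν).eq_or_snoc_prefix hμt h).resolve_left fun e => hnot (e ▸ hν)
  by_cases e : K = J
  · exact .inl (e ▸ hK)
  · right
    obtain ⟨r, rfl⟩ := hK
    rw [← overlap_nodeFun, nodeFun, nodeFun, nodeOp_snoc_append, nodeOp_snoc, nodeOp_snoc,
      LinearMap.comp_apply, LinearMap.comp_apply, LinearMap.comp_apply, hμt.scalesOverlap hβ,
      overlap_compress_of_ne
        (((htree _ hν).of_snoc_prefix ⟨r, rfl⟩).2.trans hJ.symm) e, mul_zero]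

end DES

end BRS

end

theorem mainTheorem10 (p : ℝ≥0∞) (hp1 : 1 < p) (hp : p < ∞) (U : BRS.LimitEmbeddings p)
    (α β : Ordinal.{0}) (hα : α < ω₁) (hβ : β < ω₁) (E F : Set BRS.Node)
    (hE : BRS.IsIntervalBranching α E) (hF : BRS.IsIntervalBranching β F) (Ψ : BRS.DES U E F)
    (μ₀ : BRS.Node) (hμ₀ : μ₀ ∈ F) (l₀ : BRS.Node) (hl₀ : l₀ ∈ E)
    (hne : (Ψ.Gamma l₀ μ₀).Nonempty)
    (hmin : ∀ l ∈ E, l <+: l₀ → (Ψ.Gamma l μ₀).Nonempty → l = l₀) :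
    (∀ l ∈ E, l₀ <+: l →
      ∑ ν ∈ Ψ.Gamma l μ₀, BRS.theta ν = BRS.theta μ₀ * (BRS.theta l / BRS.theta l₀)) ∧
    (μ₀ ∉ Ψ.M l₀ →
      ∀ J : BRS.DyadicInterval, J.level = BRS.kappa μ₀ → ∀ l ∈ E, l₀ <+: l →
        ∑ ν ∈ Ψ.Gamma l (BRS.snoc μ₀ J), BRS.theta ν =
          BRS.theta μ₀ * J.length * (BRS.theta l / BRS.theta l₀)) ∧
    (μ₀ ∈ Ψ.M l₀ →
      ∀ I : BRS.DyadicInterval, I.level = BRS.kappa l₀ →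
      ∀ J ∈ BRS.dyadicAlong (Ψ.J l₀ μ₀) I, ∀ l ∈ E, BRS.snoc l₀ I <+: l →
        ∑ ν ∈ Ψ.Gamma l (BRS.snoc μ₀ J), BRS.theta ν =
          BRS.theta μ₀ * (J.length / I.length) * (BRS.theta l / BRS.theta l₀)) := by
  have hE' := hE.1
  have hF' := hF.1.1
  have hθ₀ := BRS.theta_pos l₀
  have hθμ := BRS.theta_pos μ₀
  have hbase := Ψ.sum_Gamma_eq_theta hE' hF' hβ hμ₀ hl₀ hne hmin
  refine ⟨fun l hl hl₀l => ?_, fun hnot J hJ l hl hl₀l => ?_, fun hmem I hI J hJ l hl hIl => ?_⟩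
  · rw [Ψ.sum_Gamma_eq_mul hE' hF' hβ (div_pos hθμ hθ₀) (fun k hk hk' h => ?_) l hl hl₀l]
    · ring
    -- The only first node of E at or beyond l₀ is l₀ itself.
    · obtain rfl := h l₀ hl₀ List.prefix_rfl hk'
      rw [hbase]; field_simp
  · have hJ' := Ψ.sum_Gamma_snoc_eq_theta hF' hβ hμ₀ hl₀ hbase hnot hJ
    rw [Ψ.sum_Gamma_eq_mul hE' hF' hβ (div_pos (mul_pos hθμ J.length_pos) hθ₀)
      (fun k hk hk' h => ?_) l hl hl₀l]
    · ring
    · obtain rfl := h l₀ hl₀ List.prefix_rfl hk'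
      rw [hJ', BRS.theta_snoc]; field_simp
  · have hI0 := I.length_pos
    rw [Ψ.sum_Gamma_eq_mul hE' hF' hβ
      (div_pos (mul_pos hθμ J.length_pos) (mul_pos hI0 hθ₀)) (fun k hk hk' h => ?_) l hl hIl]
    · field_simp
    · have hlk : l₀ <+: k := (BRS.prefix_snoc l₀ I).trans hk'
      have hnek : l₀ ≠ k := by
        rintro rfl
        simpa [BRS.snoc] using hk'.length_le
      obtain ⟨l₁, I₁, hpred, hI₁, hIl₁, hθ⟩ :=
        BRS.exists_immediatePred hE' hk ⟨l₀, hl₀, hlk, hnek⟩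
      have hl₁ : l₀ <+: l₁ := hpred.2 l₀ hl₀ hlk hnek
      -- A first node k beyond l₀⌢I is an immediate successor of l₀: a predecessor strictly beyond
      -- l₀ would already extend l₀⌢I.
      obtain rfl : l₀ = l₁ := by
        by_contra hne'
        exact hpred.1.2.2 (h l₁ hpred.1.1
          (BRS.snoc_prefix_of_prefix hk' hpred.1.2.1 hl₁ hne') hpred.1.2.1)
      obtain rfl := BRS.snoc_prefix_unique hk' hIl₁
      rw [Ψ.sum_Gamma_snoc_eq hE'.1 hF' hβ hk hpred hI₁ hIl₁ hθ hmem hJ, BRS.theta_snoc, hθ]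
      field_simp
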